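/- **Terms.** Fix $N\in\mathbb N$, identities $\mathcal S_{id}=\{ID_1,\dots,ID_N\}$, and a further dummy identity $ID_{dum}$ which only the network knows; $A$ ranges over $\mathcal S_{id}\cup\{ID_{dum}\}$. Ground terms are built from *names* (independent random samplings): $n_{hn}$ (key seed of the network), $n^j$ (challenge) and $\mathrm{GUTI}^j$ of the network session $j\in\mathbb N$, encryption randomness $n_e^{ID,j}$, keys $k^{A},k_m^{A}$, and infinitely many further names; and from the *function symbols* $\langle\_,\_\rangle,\langle\_,\_,\_\rangle,\pi_1,\pi_2,\pi_3$ (projections; on pairs and on triples), $\{m\}^{r}_{pk}$ (encryption), $dec$, $pk$, $sk$, $\mathrm{if\,then\,else}$, $true$, $false$, $eq$, $geq$, $len$, $Mac^1_k,\dots,Mac^5_k$, $f_k$, $f^r_k$, $\oplus$, $suc$, $range$, $+$, $-$, $0$, $1$, $A^x$ (repetition), the constants $ID\in\mathcal S_{id}$, $\bot$, UnknownId, fail, UnSet, NoGuti, ok, error, RequestChallenge, initial sequence numbers $\mathrm{init}_{ue}^{ID}$, $\mathrm{init}_{hn}^{A}$, and countably many adversarial symbols of every arity. Write $u=v$ for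 $eq(u,v)$, $u\ge v$ for $geq(u,v)$, and $\neg b$, $b\wedge c$, $b\vee c$, $b\to c$ for the conditionals $\mathrm{if}\ b\ \mathrm{then}\ false\ \mathrm{else}\ true$, $\mathrm{if}\ b\ \mathrm{then}\ c\ \mathrm{else}\ false$, $\mathrm{if}\ b\ \mathrm{then}\ true\ \mathrm{else}\ c$, $\mathrm{if}\ b\ \mathrm{then}\ c\ \mathrm{else}\ true$. Finite disjunctions and conjunctions are iterated, with $false$ and $true$ for the empty ones. $pk_{hn}=pk(n_{hn})$, $sk_{hn}=sk(n_{hn})$. **Derivations.** Let $\sim$ be a binary relation between finite sequences of ground terms; $s\doteq t$ abbreviates $eq(s,t)\sim true$. A *derivation* is a derivation of some $\vec u\sim\vec v$ from the following axioms and rules. *Axioms without premise.* $g(\vec a,\mathrm{if}\,b\,\mathrm{then}\,x\,\mathrm{else}\,y,\vec c)\doteq \mathrm{if}\,b\,\mathrm{then}\,g(\vec a,x,\vec c)\,\mathrm{else}\,g(\vec a,y,\vec c)$ for every symbol $g$ other than the conditional. The laws of conditionals, with $[b,x,y]$ for $\mathrm{if}\,b\,\mathrm{then}\,x\,\mathrm{else}\,y$: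 $[[b,a,c],x,y]\doteq[b,[a,x,y],[c,x,y]]$; $[true,x,y]\doteq x$; $[false,x,y]\doteq y$; $[b,x,x]\doteq x$; $[b,[b,x,y],z]\doteq[b,x,z]$; $[b,x,[b,y,z]]\doteq[b,x,z]$; $[b,[a,x,y],z]\doteq[a,[b,x,z],[b,y,z]]$; $[b,x,[a,y,z]]\doteq[a,[b,x,y],[b,x,z]]$. Projections of pairs and triples; $dec(\{x\}^z_{pk(y)},sk(y))\doteq x$; $(x=x)\doteq true$; $(A=B)\doteq false$ for distinct $A,B$ in $\mathcal C=\mathcal S_{id}\cup\{\bot,\text{UnknownId},\text{fail},0,1\}$; $(t=n)\doteq false$ if the name $n$ does not occur in $t$. $len(ID)\doteq len(ID')$, $len(suc(\mathrm{init}_{ue}^{ID}))\doteq len(\mathrm{init}_{ue}^{ID})\doteq len(\mathrm{init}_{ue}^{ID'})$, $len(0^x)\doteq x$, $len(1^x)\doteq x$, $(len(A)=0)\doteq false$ for $A\in\mathcal C$. $(\neg(u=s)\wedge\langle u,v\rangle=\langle s,t\rangle)\doteq false$, $(\neg(v=t)\wedge\langle u,v\rangle=\langle s,t\rangle)\doteq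 false$, $(\neg(u=v)\wedge\{u\}^r_{pk(n)}=\{v\}^{r'}_{pk(n')})\doteq false$ ($n,n',r,r'$ names). $range(u,v)\doteq(u=v)$, $suc(u)\doteq u+1$, $(\mathrm{init}_{ue}^{ID}\ge\mathrm{init}_{hn}^{ID})\doteq true$, and $\varphi[\vec u]\doteq true$ for every quantifier-free formula $\varphi$ of linear arithmetic ($+,-,0,1,=,\le$) that is valid over $\mathbb Z$. *Structural rules.* $\sim$ is an equivalence relation, closed under simultaneous permutation, duplication of the last term, removal of the last term, and application of a function symbol ($\vec x,\vec y\sim\vec x',\vec y'$ gives $g(\vec x),\vec y\sim g(\vec x'),\vec y'$). If $\vec u,s\sim\vec v$ and $s\doteq t$ then $\vec u,t\sim\vec v$. If the name $n$ does not occur in $\vec u,\vec v$ and $\vec u\sim\vec v$ then $\vec u,n\sim\vec v,n$. If $n$ does not occur in $\vec u,t$ and $\vec u,n\sim\vec v$ then $\vec u,t\oplus n\sim\vec v$. From $\vec w,b,(x_i)_i\sim\vec w',b',(x_i')_i$ and $\vec w,b,(y_i)_i\sim\vec w',b',(y'_i)_i$ infer $\vec w,([b,x_i,y_i])_i\sim\vec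 w',([b',x'_i,y'_i])_i$. From $len(u)\doteq len(s)$ and $len(v)\doteq len(t)$ infer $len(\langle u,v\rangle)\doteq len(\langle s,t\rangle)$; from $(len(u)=0)\doteq false$ infer $(len(\langle u,v\rangle)=0)\doteq false$ and $(len(\langle v,u\rangle)=0)\doteq false$; from $(A=B)\doteq false$, $(len(A)=0)\doteq false$, $(x=0)\doteq false$ infer $(A^x=B^y)\doteq false$. *Cryptographic rules.* (CCA1) For names $n,n',r,r'$ with $r,r'$ not occurring in $\vec u,\vec v,s,t$, where the first terms of $\vec u$ and $\vec v$ are $pk(n)$ and $pk(n')$, where $n$ occurs in $\vec u,s$ only in $pk(n)$ and in decryptions $dec(\cdot,sk(n))$, and likewise $n'$ in $\vec v,t$: from $\vec u,len(s)\sim\vec v,len(s)$ and $len(s)\doteq len(t)$ infer $\vec u,\{s\}^r_{pk(n)}\sim\vec v,\{t\}^{r'}_{pk(n')}$. (PRF) Let $h$ be one of $Mac^1,\dots,Mac^5,f,f^r$, let the name $k$ occur in $\vec u,m$ only in key positions of the $Mac$'s (for $Mac^i$), respectively of $f$ and $f^r$ (for $f$ and $f^r$), let $S$ list all $x$ such that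 $h_k(x)$ is a subterm of $\vec u,m$, let $c=\bigvee_{x\in S}m=x$, and let the name $n$ not occur in $\vec u,m$. Then $\vec u,[c,0,h_k(m)]\sim\vec u,[c,0,n]$. (EUF-MAC) If $k$ occurs in $s,m$ only as key of the $Mac$'s and $S$ lists all $x$ such that $Mac^j_k(x)$ is a subterm of $s$ or $m$, then $\big(s=Mac^j_k(m)\to\bigvee_{x\in S}s=Mac^j_k(x)\big)\sim true$. (CR) If $k$ occurs in $m_1,m_2$ only as key of the $Mac$'s, then $\big(Mac^j_k(m_1)=Mac^j_k(m_2)\to m_1=m_2\big)\sim true$. A boolean term $b$ *holds* if $b\sim true$ has a derivation. **The protocol ($\mathrm{AKA}^+$).** The actions are $NS_{ID}(j)$ (reset), $PU_{ID}(j,0),PU_{ID}(j,1),PU_{ID}(j,2)$, $TU_{ID}(j,0),TU_{ID}(j,1)$, $FU_{ID}(j)$ of session $j$ of the user $ID$, and $PN(j,0),PN(j,1),TN(j,0),TN(j,1),FN(j)$ of the network session $j$ ($ID\in\mathcal S_{id}$, $j\in\mathbb N$). A symbolic state maps the variables $sqn_{ue}^{ID}$, $sqn_{hn}^A$, $guti_{ue}^{ID}$,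 $guti_{hn}^A$, $eauth_{ue}^{ID}$, $bauth_{ue}^{ID}$, $eauth_{hn}^j$, $bauth_{hn}^j$, $sguti^{ID}$, $vguti^{ID}$, $sess^{ID}$, $sync^{ID}$ to terms. Initially they are $\mathrm{init}_{ue}^{ID}$, $\mathrm{init}_{hn}^A$, UnSet, UnSet, fail, fail, fail, fail, and $false$ for the last four; the initial frame (list of messages) is $pk_{hn}$. An action executed in state $\sigma$ and frame $\phi$ has input $g=g(\phi)$, for a fixed family of adversarial symbols $g$; it appends its output to the frame and updates the state simultaneously as follows, where all variables on the right are read in $\sigma$ and the variables not mentioned are unchanged. Write $\mathrm{chain}_{ID}(c_{ID}:x_{ID};d)$ for $\mathrm{if}\ c_{ID_1}\,\mathrm{then}\ x_{ID_1}\ \mathrm{else\ if}\ c_{ID_2}\dots\mathrm{else}\ d$. - $NS_{ID}(j)$: no output; $vguti^{ID},sync^{ID}:=false$. - $PU_{ID}(j,0)$: outputs RequestChallenge. - $PU_{ID}(j,1)$: outputs $\langle e,Mac^1_{k_m^{ID}}(\langle e,g\rangle)\rangle$ with $e=\{\langle ID,sqn_{ue}^{ID}\rangle\}^{n_e^{ID,j}}_{pk_{hn}}$;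 $sqn_{ue}^{ID}:=suc(sqn_{ue}^{ID})$, $bauth_{ue}^{ID}:=g$, $eauth_{ue}^{ID}:=\text{fail}$, $guti_{ue}^{ID}:=\text{UnSet}$, $vguti^{ID}:=false$. - $PU_{ID}(j,2)$: let $a=(g=Mac^2_{k_m^{ID}}(\langle bauth_{ue}^{ID},sqn_{ue}^{ID}\rangle))$; outputs $[a,\text{ok},\text{error}]$; $eauth_{ue}^{ID}:=[a,bauth_{ue}^{ID},\text{fail}]$, $sync^{ID}:=sync^{ID}\vee a$. - $TU_{ID}(j,0)$: outputs $[vguti^{ID},guti_{ue}^{ID},\text{NoGuti}]$; $sguti^{ID}:=vguti^{ID}$, $vguti^{ID}:=false$, $eauth_{ue}^{ID},bauth_{ue}^{ID}:=\text{fail}$. - $TU_{ID}(j,1)$: let $q=\pi_2(g)\oplus f_{k^{ID}}(\pi_1(g))$ and $a=\big(\pi_3(g)=Mac^3_{k_m^{ID}}(\langle\pi_1(g),q,guti_{ue}^{ID}\rangle)\big)\wedge(sguti^{ID}\wedge range(sqn_{ue}^{ID},q))$; outputs $[a,Mac^4_{k_m^{ID}}(\pi_1(g)),\text{error}]$; $bauth_{ue}^{ID},eauth_{ue}^{ID}:=[a,\pi_1(g),\text{fail}]$,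 $sqn_{ue}^{ID}:=[a,suc(sqn_{ue}^{ID}),sqn_{ue}^{ID}]$. - $FU_{ID}(j)$: let $t=\pi_1(g)\oplus f^r_{k^{ID}}(eauth_{ue}^{ID})$ and $a=\big(\pi_2(g)=Mac^5_{k_m^{ID}}(\langle t,eauth_{ue}^{ID}\rangle)\big)\wedge(\neg(eauth_{ue}^{ID}=\text{fail})\wedge\neg(eauth_{ue}^{ID}=\bot))$; outputs $[a,\text{ok},\text{error}]$; $vguti^{ID}:=a$, $guti_{ue}^{ID}:=[a,t,\text{UnSet}]$. - $PN(j,0)$: outputs $n^j$. - $PN(j,1)$: let $d=dec(\pi_1(g),sk_{hn})$, $a_{ID}=\big(\pi_2(g)=Mac^1_{k_m^{ID}}(\langle\pi_1(g),n^j\rangle)\big)\wedge(\pi_1(d)=ID)$, $i_{ID}=a_{ID}\wedge(\pi_2(d)\ge sqn_{hn}^{ID})$; outputs $\mathrm{chain}_{ID}(a_{ID}:Mac^2_{k_m^{ID}}(\langle n^j,suc(\pi_2(d))\rangle);\text{UnknownId})$; $bauth_{hn}^j,eauth_{hn}^j:=\mathrm{chain}_{ID}(a_{ID}:ID;\text{UnknownId})$,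 and for every $ID\in\mathcal S_{id}$: $sess^{ID}:=[i_{ID},n^j,sess^{ID}]$, $guti_{hn}^{ID}:=[i_{ID},\mathrm{GUTI}^j,guti_{hn}^{ID}]$, $sqn_{hn}^{ID}:=[i_{ID},suc(\pi_2(d)),sqn_{hn}^{ID}]$. - $TN(j,0)$: let $a_{ID}=(guti_{hn}^{ID}=g)\wedge\neg(guti_{hn}^{ID}=\text{UnSet})$ and $m_A=\langle n^j,sqn_{hn}^A\oplus f_{k^A}(n^j),Mac^3_{k_m^A}(\langle n^j,sqn_{hn}^A,guti_{hn}^A\rangle)\rangle$; outputs $\mathrm{chain}_{ID}(a_{ID}:m_{ID};m_{ID_{dum}})$; $bauth_{hn}^j:=\mathrm{chain}_{ID}(a_{ID}:ID;\text{UnknownId})$, and for every $ID\in\mathcal S_{id}$: $guti_{hn}^{ID}:=[a_{ID},\text{UnSet},guti_{hn}^{ID}]$, $sess^{ID}:=[a_{ID},n^j,sess^{ID}]$. - $TN(j,1)$: let $a_{ID}=(g=Mac^4_{k_m^{ID}}(n^j))\wedge(bauth_{hn}^j=ID)$, $i_{ID}=a_{ID}\wedge(sess^{ID}=n^j)$;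 outputs $[\bigvee_{ID}a_{ID},\text{ok},\text{error}]$; $eauth_{hn}^j:=\mathrm{chain}_{ID}(a_{ID}:ID;\text{UnknownId})$, and for every $ID\in\mathcal S_{id}$: $sqn_{hn}^{ID}:=[i_{ID},suc(sqn_{hn}^{ID}),sqn_{hn}^{ID}]$, $guti_{hn}^{ID}:=[i_{ID},\mathrm{GUTI}^j,guti_{hn}^{ID}]$. - $FN(j)$: outputs $\mathrm{chain}_{ID}\big(eauth_{hn}^j=ID:\langle \mathrm{GUTI}^j\oplus f^r_{k^{ID}}(n^j),Mac^5_{k_m^{ID}}(\langle \mathrm{GUTI}^j,n^j\rangle)\rangle;\text{UnknownId}\big)$. **Valid traces.** A symbolic trace is a finite sequence of actions. It is *valid* if (i) for every $ID$, its subsequence of actions of $ID$ is empty or starts with $NS_{ID}(j)$, $PU_{ID}(j,0)$ or $TU_{ID}(j,0)$ for some $j$, or with $PU_{ID}(0,1)$, and consecutive actions in it are $PU_{ID}(j,0)\,PU_{ID}(j,1)$, $PU_{ID}(j,1)\,PU_{ID}(j,2)$, $PU_{ID}(j,2)\,FU_{ID}(j)$, $TU_{ID}(j,0)\,TU_{ID}(j,1)$,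 $TU_{ID}(j,1)\,FU_{ID}(j)$, or any action of a session $i$ followed by $NS_{ID}(j)$, $PU_{ID}(j,0)$ or $TU_{ID}(j,0)$ with $j>i$; (ii) for every $j$, its subsequence of actions of the network session $j$ is a (possibly empty) prefix of $PN(j,0)\,PN(j,1)\,FN(j)$ or of $TN(j,0)\,TN(j,1)\,FN(j)$; (iii) every action of the network session $j+1$, unless it is the first action of the trace, is preceded by some action of the network session $j$. For a trace $\tau$, let $\sigma^{in}_\tau$ be the symbolic state just before the last action of $\tau$ (the initial state if $\tau$ is empty). **Theorem (authentication of the network by the user).** Let $\tau$ be a valid symbolic trace and $ID\in\mathcal S_{id}$. 1. For every $j\in\mathbb N$, the following boolean term holds, where $\tau'$ ranges over all prefixes of $\tau$, including $\tau$: $$\sigma^{in}_\tau(eauth_{ue}^{ID})=n^j\ \to\ \bigvee_{\tau'\preceq\tau}\sigma^{in}_{\tau'}(bauth_{hn}^j)=ID .$$ 2. Put $\mathrm{suc\text{-}auth}_\tau(ID)\equiv\neg(\sigma^{in}_\tau(eauth_{ue}^{ID})=\text{fail})\wedge\neg(\sigma^{in}_\tau(eauth_{ue}^{ID})=\bot)$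 and $\mathrm{auth}_\tau(ID,j)\equiv(\sigma^{in}_\tau(bauth_{hn}^j)=ID)\wedge(n^j=\sigma^{in}_\tau(eauth_{ue}^{ID}))$. For every finite list $J$ of natural numbers that contains the number of every network session with an action in $\tau$, the following holds: $$\mathrm{suc\text{-}auth}_\tau(ID)\ \to\ \bigvee_{j\in J}\mathrm{auth}_\tau(ID,j).$$ 3. (Injective authentication.) For every such $J$, the following holds: $$\mathrm{suc\text{-}auth}_\tau(ID)\ \to\ \bigvee_{j\in J}\Big(\mathrm{auth}_\tau(ID,j)\wedge\bigwedge_{i\in J,\,i\ne j}\neg\,\mathrm{auth}_\tau(ID,i)\Big).$$ -/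

import Mathlib

namespace AKA

/-! ## Terms

There are `N` identities, represented by `Fin N`.  The network additionally keeps the record of a
dummy identity, so that network-side records are indexed by `Agent N`, where `none` is the dummy. -/

/-- The identities, together with the dummy identity `none`. -/
abbrev Agent (N : ℕ) : Type := Option (Fin N)

/-- Names: they stand for independent uniform random samplings. -/
inductive Name (N : ℕ) : Type
  /-- the seed of the key pair of the network -/
  | hn : Name N
  /-- the challenge of the network session `j` -/
  | chal (j : ℕ) : Name N
  /-- the temporary identity generated by the network session `j` -/
  | guti (j : ℕ) : Name N
  /-- the encryption randomness of the user session `j` of the identity `ID` -/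
  | encRand (ID : Fin N) (j : ℕ) : Name N
  /-- the confidentiality key -/
  | key (a : Agent N) : Name N
  /-- the integrity key -/
  | mkey (a : Agent N) : Name N
  /-- a reserve of further names -/
  | extra (k : ℕ) : Name N

/-- The five integrity functions. -/
inductive MacTag : Type
  | m1 | m2 | m3 | m4 | m5

/-- Function symbols. -/
inductive Sym (N : ℕ) : Type
  /-- the `k`-th adversarial function symbol of arity `n` -/
  | adv (k n : ℕ) : Sym N
  | pair : Sym N
  | triple : Sym N
  | fst : Sym N
  | snd : Sym N
  | thd : Sym N
  /-- `enc(m, pk, r)` -/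
  | enc : Sym N
  | dec : Sym N
  | pk : Sym N
  | sk : Sym N
  | ite : Sym N
  | tt : Sym N
  | ff : Sym N
  | eq : Sym N
  | geq : Sym N
  | len : Sym N
  /-- the integrity functions; the second argument is the key -/
  | mac (j : MacTag) : Sym N
  /-- the confidentiality function `f`; the second argument is the key -/
  | owf : Sym N
  /-- the confidentiality function `fʳ`; the second argument is the key -/
  | rowf : Sym N
  | xor : Sym N
  | sqnSuc : Sym N
  | range : Sym N
  | add : Sym N
  | sub : Sym N
  | zero : Sym N
  | one : Sym N
  /-- the repetition `A ^ x` -/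
  | rep : Sym N
  | ident (ID : Fin N) : Sym N
  | bot : Sym N
  | unknownId : Sym N
  | fail : Sym N
  | unset : Sym N
  | noGuti : Sym N
  | ok : Sym N
  | error : Sym N
  | requestChallenge : Sym N
  | sqnInitUE (ID : Fin N) : Sym N
  | sqnInitHN (a : Agent N) : Sym N

/-- Arities of the function symbols. -/
@[reducible] def Sym.arity {N : ℕ} : Sym N → ℕ
  | .adv _ n => n
  | .pair | .dec | .eq | .geq | .mac _ | .owf | .rowf | .xor | .range | .add | .sub | .rep => 2
  | .triple | .enc | .ite => 3
  | .fst | .snd | .thd | .pk | .sk | .len | .sqnSuc => 1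
  | .tt | .ff | .zero | .one | .ident _ | .bot | .unknownId | .fail | .unset | .noGuti | .ok
  | .error | .requestChallenge | .sqnInitUE _ | .sqnInitHN _ => 0

/-- Ground terms over the function symbols and the names. -/
inductive Term (N : ℕ) : Type
  | name (n : Name N) : Term N
  | app (f : Sym N) (args : Fin f.arity → Term N) : Term N

namespace Term

variable {N : ℕ}

/-- A constant. -/
def cst (f : Sym N) (h : f.arity = 0 := by rfl) : Term N := app f (fun i => (Fin.cast h i).elim0)

def pair (x y : Term N) : Term N := app .pair ![x, y]
def triple (x y z : Term N) : Term N := app .triple ![x, y, z]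
def fst (x : Term N) : Term N := app .fst ![x]
def snd (x : Term N) : Term N := app .snd ![x]
def thd (x : Term N) : Term N := app .thd ![x]
def enc (m k r : Term N) : Term N := app .enc ![m, k, r]
def dec (c k : Term N) : Term N := app .dec ![c, k]
def pk (x : Term N) : Term N := app .pk ![x]
def sk (x : Term N) : Term N := app .sk ![x]
def ite (b x y : Term N) : Term N := app .ite ![b, x, y]
def tt : Term N := cst .tt
def ff : Term N := cst .ff
def eq (x y : Term N) : Term N := app .eq ![x, y]
def geq (x y : Term N) : Term N := app .geq ![x, y]
def len (x : Term N) : Term N := app .len ![x]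
def mac (j : MacTag) (m k : Term N) : Term N := app (.mac j) ![m, k]
def owf (m k : Term N) : Term N := app .owf ![m, k]
def rowf (m k : Term N) : Term N := app .rowf ![m, k]
def xor (x y : Term N) : Term N := app .xor ![x, y]
def sqnSuc (x : Term N) : Term N := app .sqnSuc ![x]
def range (x y : Term N) : Term N := app .range ![x, y]
def add (x y : Term N) : Term N := app .add ![x, y]
def sub (x y : Term N) : Term N := app .sub ![x, y]
def zero : Term N := cst .zero
def one : Term N := cst .one
def rep (A x : Term N) : Term N := app .rep ![A, x]
def ident (ID : Fin N) : Term N := cst (.ident ID)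
def bot : Term N := cst .bot
def unknownId : Term N := cst .unknownId
def fail : Term N := cst .fail
def unset : Term N := cst .unset
def noGuti : Term N := cst .noGuti
def ok : Term N := cst .ok
def error : Term N := cst .error
def requestChallenge : Term N := cst .requestChallenge
def sqnInitUE (ID : Fin N) : Term N := cst (.sqnInitUE ID)
def sqnInitHN (a : Agent N) : Term N := cst (.sqnInitHN a)

/-- The adversary's input `g(φ)` computed from the frame `φ`. -/
def advInput (φ : List (Term N)) : Term N := app (.adv 0 φ.length) (fun i => φ.get i)

/-! Boolean connectives are abbreviations for conditionals. -/

def not (b : Term N) : Term N := ite b ff tt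
def and (b c : Term N) : Term N := ite b c ff
def or (b c : Term N) : Term N := ite b tt c
def imp (b c : Term N) : Term N := ite b c tt

/-- Finite disjunction. -/
def disj (l : List (Term N)) : Term N := l.foldr or ff

/-- Finite conjunction. -/
def conj (l : List (Term N)) : Term N := l.foldr and tt

/-- `s` is a subterm of the given term. -/
def IsSubterm (s : Term N) : Term N → Prop
  | name n => s = name n
  | app f a => s = app f a ∨ ∃ i, IsSubterm s (a i)

/-- `s` occurs in the given term only as an immediate argument of a function symbol, at a
position `(f, i)` satisfying `P`. -/
def OnlyAt (s : Term N) (P : (f : Sym N) → Fin f.arity → Prop) : Term N → Prop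
  | name n => s ≠ name n
  | app f a => s ≠ app f a ∧ ∀ i, (a i = s ∧ P f i) ∨ OnlyAt s P (a i)

end Term

/-- The name `n` does not occur in `l`. -/
def Fresh {N : ℕ} (n : Name N) (l : List (Term N)) : Prop :=
  ∀ t ∈ l, ¬ Term.IsSubterm (.name n) t

/-- Seed positions: `pk(·)` and `sk(·)`. -/
def IsSeedPos {N : ℕ} : (f : Sym N) → Fin f.arity → Prop
  | .pk, _ => True
  | .sk, _ => True
  | _, _ => False

/-- Decryption key position: `dec(_, ·)`. -/
def IsDecKeyPos {N : ℕ} : (f : Sym N) → Fin f.arity → Prop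
  | .dec, i => i = 1
  | _, _ => False

/-- Key positions of the integrity functions. -/
def IsMacKeyPos {N : ℕ} : (f : Sym N) → Fin f.arity → Prop
  | .mac _, i => i = 1
  | _, _ => False

/-- Key positions of the confidentiality functions. -/
def IsOwfKeyPos {N : ℕ} : (f : Sym N) → Fin f.arity → Prop
  | .owf, i => i = 1
  | .rowf, i => i = 1
  | _, _ => False

/-- The seed `n` is only used to build the public key `pk(n)`, and decryptions under `sk(n)`. -/
def SeedSafe {N : ℕ} (n : Name N) (l : List (Term N)) : Prop :=
  ∀ t ∈ l, Term.OnlyAt (.name n) IsSeedPos t ∧ Term.OnlyAt (Term.sk (.name n)) IsDecKeyPos t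

/-- The name `k` occurs only as a key of the integrity functions. -/
def MacKeySafe {N : ℕ} (k : Name N) (l : List (Term N)) : Prop :=
  ∀ t ∈ l, Term.OnlyAt (.name k) IsMacKeyPos t

/-- The name `k` occurs only as a key of the confidentiality functions. -/
def OwfKeySafe {N : ℕ} (k : Name N) (l : List (Term N)) : Prop :=
  ∀ t ∈ l, Term.OnlyAt (.name k) IsOwfKeyPos t

/-- `S` enumerates the terms `m` such that `H m` is a subterm of `l`. -/
def Enumerates {N : ℕ} (H : Term N → Term N) (l S : List (Term N)) : Prop :=
  ∀ m, m ∈ S ↔ ∃ t ∈ l, Term.IsSubterm (H m) t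

/-- The program constants. -/
inductive IsProgramConst {N : ℕ} : Term N → Prop
  | ident (ID : Fin N) : IsProgramConst (Term.ident ID)
  | bot : IsProgramConst Term.bot
  | unknownId : IsProgramConst Term.unknownId
  | fail : IsProgramConst Term.fail
  | zero : IsProgramConst Term.zero
  | one : IsProgramConst Term.one

/-! ## Linear integer arithmetic -/

/-- Terms of linear integer arithmetic. -/
inductive ArithTerm : Type
  | var (i : ℕ) : ArithTerm
  | zero : ArithTerm
  | one : ArithTerm
  | add (s t : ArithTerm) : ArithTerm
  | sub (s t : ArithTerm) : ArithTerm

/-- Quantifier-free formulas of linear integer arithmetic. -/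
inductive ArithFormula : Type
  | eq (s t : ArithTerm) : ArithFormula
  | le (s t : ArithTerm) : ArithFormula
  | not (φ : ArithFormula) : ArithFormula
  | and (φ ψ : ArithFormula) : ArithFormula
  | or (φ ψ : ArithFormula) : ArithFormula
  | imp (φ ψ : ArithFormula) : ArithFormula

def ArithTerm.eval (v : ℕ → ℤ) : ArithTerm → ℤ
  | var i => v i
  | zero => 0
  | one => 1
  | add s t => s.eval v + t.eval v
  | sub s t => s.eval v - t.eval v

def ArithFormula.eval (v : ℕ → ℤ) : ArithFormula → Prop
  | eq s t => s.eval v = t.eval v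
  | le s t => s.eval v ≤ t.eval v
  | not φ => ¬ φ.eval v
  | and φ ψ => φ.eval v ∧ ψ.eval v
  | or φ ψ => φ.eval v ∨ ψ.eval v
  | imp φ ψ => φ.eval v → ψ.eval v

/-- Validity over the integers. -/
def ArithFormula.Valid (φ : ArithFormula) : Prop := ∀ v : ℕ → ℤ, φ.eval v

/-- The instance of an arithmetic term by the ground terms `u`. -/
def ArithTerm.inst {N : ℕ} (u : ℕ → Term N) : ArithTerm → Term N
  | var i => u i
  | zero => Term.zero
  | one => Term.one
  | add s t => Term.add (s.inst u) (t.inst u)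
  | sub s t => Term.sub (s.inst u) (t.inst u)

/-- The instance `φ[u]` of an arithmetic formula by the ground terms `u`. -/
def ArithFormula.inst {N : ℕ} (u : ℕ → Term N) : ArithFormula → Term N
  | eq s t => Term.eq (s.inst u) (t.inst u)
  | le s t => Term.geq (t.inst u) (s.inst u)
  | not φ => Term.not (φ.inst u)
  | and φ ψ => Term.and (φ.inst u) (ψ.inst u)
  | or φ ψ => Term.or (φ.inst u) (ψ.inst u)
  | imp φ ψ => Term.imp (φ.inst u) (ψ.inst u)

/-! ## The axioms -/

section Axioms

open Term

/-- The axioms asserting that two terms are equal except with negligible probability, i.e. that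
`eq(s, t) ∼ true`, and which have no premise: `EqAx s t` is the axiom `s ≐ t`. -/
inductive EqAx {N : ℕ} : Term N → Term N → Prop
  /- Conditionals. -/
  | iteHom (f : Sym N) (hf : f ≠ .ite) (a : Fin f.arity → Term N) (i : Fin f.arity)
      (b x y : Term N) :
      EqAx (app f (Function.update a i (ite b x y)))
        (ite b (app f (Function.update a i x)) (app f (Function.update a i y)))
  | iteIte (a b c x y : Term N) :
      EqAx (ite (ite b a c) x y) (ite b (ite a x y) (ite c x y))
  | iteTrue (x y : Term N) : EqAx (ite tt x y) x
  | iteFalse (x y : Term N) : EqAx (ite ff x y) y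
  | iteSame (b x : Term N) : EqAx (ite b x x) x
  | iteThen (b x y z : Term N) : EqAx (ite b (ite b x y) z) (ite b x z)
  | iteElse (b x y z : Term N) : EqAx (ite b x (ite b y z)) (ite b x z)
  | iteSwapThen (a b x y z : Term N) :
      EqAx (ite b (ite a x y) z) (ite a (ite b x z) (ite b y z))
  | iteSwapElse (a b x y z : Term N) :
      EqAx (ite b x (ite a y z)) (ite a (ite b x y) (ite b x z))
  /- Equality and disequality. -/
  | fstPair (x y : Term N) : EqAx (fst (pair x y)) x
  | sndPair (x y : Term N) : EqAx (snd (pair x y)) y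
  | fstTriple (x y z : Term N) : EqAx (fst (triple x y z)) x
  | sndTriple (x y z : Term N) : EqAx (snd (triple x y z)) y
  | thdTriple (x y z : Term N) : EqAx (thd (triple x y z)) z
  | decEnc (x y z : Term N) : EqAx (dec (enc x (pk y) z) (sk y)) x
  | eqRefl (x : Term N) : EqAx (eq x x) tt
  | neqConst (A B : Term N) (hA : IsProgramConst A) (hB : IsProgramConst B) (h : A ≠ B) :
      EqAx (eq A B) ff
  | eqIndep (t : Term N) (n : Name N) (h : Fresh n [t]) : EqAx (eq t (name n)) ff
  /- Lengths. -/
  | lenIdent (ID₁ ID₂ : Fin N) : EqAx (len (ident ID₁)) (len (ident ID₂))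
  | lenSqnSuc (ID : Fin N) : EqAx (len (sqnSuc (sqnInitUE ID))) (len (sqnInitUE ID))
  | lenSqnInit (ID₁ ID₂ : Fin N) : EqAx (len (sqnInitUE ID₁)) (len (sqnInitUE ID₂))
  | lenRepZero (x : Term N) : EqAx (len (rep zero x)) x
  | lenRepOne (x : Term N) : EqAx (len (rep one x)) x
  | lenConst (A : Term N) (hA : IsProgramConst A) : EqAx (eq (len A) zero) ff
  /- Injectivity. -/
  | injPairLeft (u v s t : Term N) :
      EqAx (and (not (eq u s)) (eq (pair u v) (pair s t))) ff
  | injPairRight (u v s t : Term N) :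
      EqAx (and (not (eq v t)) (eq (pair u v) (pair s t))) ff
  | injEnc (u v : Term N) (n n' r r' : Name N) :
      EqAx (and (not (eq u v))
        (eq (enc u (pk (name n)) (name r)) (enc v (pk (name n')) (name r')))) ff
  /- Sequence numbers. -/
  | rangeEq (u v : Term N) : EqAx (range u v) (eq u v)
  | sqnSucAdd (u : Term N) : EqAx (sqnSuc u) (add u one)
  | sqnInit (ID : Fin N) : EqAx (geq (sqnInitUE ID) (sqnInitHN (some ID))) tt
  | arith (φ : ArithFormula) (hφ : φ.Valid) (u : ℕ → Term N) : EqAx (φ.inst u) tt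

/-- `Deriv u v` : the indistinguishability `u ∼ v` of two sequences of ground terms has a
derivation using the axioms.  A disequality `s ≭ t` stands for `eq(s, t) ≐ false`, and `s ≐ t`
stands for `eq(s, t) ∼ true`. -/
inductive Deriv {N : ℕ} : List (Term N) → List (Term N) → Prop
  | eqAx {s t : Term N} (h : EqAx s t) : Deriv [eq s t] [tt]
  /- Structural axioms. -/
  | symm {u v : List (Term N)} (h : Deriv v u) : Deriv u v
  | refl (u : List (Term N)) : Deriv u u
  | trans {u v w : List (Term N)} (h₁ : Deriv u w) (h₂ : Deriv w v) : Deriv u v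
  | perm {n : ℕ} (x y : Fin n → Term N) (π : Equiv.Perm (Fin n))
      (h : Deriv (List.ofFn (fun i => x (π i))) (List.ofFn (fun i => y (π i)))) :
      Deriv (List.ofFn x) (List.ofFn y)
  | dup {u v : List (Term N)} {t t' : Term N} (h : Deriv (u ++ [t]) (v ++ [t'])) :
      Deriv (u ++ [t, t]) (v ++ [t', t'])
  | restr {u v : List (Term N)} {t t' : Term N} (h : Deriv (u ++ [t]) (v ++ [t'])) : Deriv u v
  | fa (f : Sym N) (x x' : Fin f.arity → Term N) {y y' : List (Term N)}
      (h : Deriv (List.ofFn x ++ y) (List.ofFn x' ++ y')) :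
      Deriv (app f x :: y) (app f x' :: y')
  | rewrite {u v : List (Term N)} {s t : Term N} (h : Deriv (u ++ [s]) v)
      (hst : Deriv [eq s t] [tt]) : Deriv (u ++ [t]) v
  | fresh {u v : List (Term N)} (n : Name N) (hn : Fresh n (u ++ v)) (h : Deriv u v) :
      Deriv (u ++ [name n]) (v ++ [name n])
  | xorIndep {u v : List (Term N)} {t : Term N} (n : Name N) (hn : Fresh n (u ++ [t]))
      (h : Deriv (u ++ [name n]) v) : Deriv (u ++ [xor t (name n)]) v
  | cs {n : ℕ} {w w' : List (Term N)} {b b' : Term N} (x y x' y' : Fin n → Term N)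
      (h₁ : Deriv (w ++ b :: List.ofFn x) (w' ++ b' :: List.ofFn x'))
      (h₂ : Deriv (w ++ b :: List.ofFn y) (w' ++ b' :: List.ofFn y')) :
      Deriv (w ++ List.ofFn (fun i => ite b (x i) (y i)))
        (w' ++ List.ofFn (fun i => ite b' (x' i) (y' i)))
  /- Length axioms with premises. -/
  | lenPair {u v s t : Term N} (h₁ : Deriv [eq (len u) (len s)] [tt])
      (h₂ : Deriv [eq (len v) (len t)] [tt]) :
      Deriv [eq (len (pair u v)) (len (pair s t))] [tt]
  | lenPairLeft {u v : Term N} (h : Deriv [eq (eq (len u) zero) ff] [tt]) :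
      Deriv [eq (eq (len (pair u v)) zero) ff] [tt]
  | lenPairRight {u v : Term N} (h : Deriv [eq (eq (len v) zero) ff] [tt]) :
      Deriv [eq (eq (len (pair u v)) zero) ff] [tt]
  | repNeq {A B x y : Term N} (h₁ : Deriv [eq (eq A B) ff] [tt])
      (h₂ : Deriv [eq (eq (len A) zero) ff] [tt]) (h₃ : Deriv [eq (eq x zero) ff] [tt]) :
      Deriv [eq (eq (rep A x) (rep B y)) ff] [tt]
  /- Cryptographic axioms. -/
  | cca {u v : List (Term N)} {s t : Term N} (n n' r r' : Name N)
      (hr : Fresh r (u ++ v ++ [s, t])) (hr' : Fresh r' (u ++ v ++ [s, t]))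
      (hu : ∃ u₀, u = pk (name n) :: u₀) (hv : ∃ v₀, v = pk (name n') :: v₀)
      (hn : SeedSafe n (u ++ [s])) (hn' : SeedSafe n' (v ++ [t]))
      (h : Deriv (u ++ [len s]) (v ++ [len s])) (hlen : Deriv [eq (len s) (len t)] [tt]) :
      Deriv (u ++ [enc s (pk (name n)) (name r)]) (v ++ [enc t (pk (name n')) (name r')])
  | prfMac (j : MacTag) (k n : Name N) (u S : List (Term N)) (m : Term N)
      (hn : Fresh n (u ++ [m])) (hk : MacKeySafe k (u ++ [m]))
      (hS : Enumerates (fun x => mac j x (name k)) (u ++ [m]) S) :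
      Deriv (u ++ [ite (disj (S.map fun x => eq m x)) zero (mac j m (name k))])
        (u ++ [ite (disj (S.map fun x => eq m x)) zero (name n)])
  | prfOwf (k n : Name N) (u S : List (Term N)) (m : Term N)
      (hn : Fresh n (u ++ [m])) (hk : OwfKeySafe k (u ++ [m]))
      (hS : Enumerates (fun x => owf x (name k)) (u ++ [m]) S) :
      Deriv (u ++ [ite (disj (S.map fun x => eq m x)) zero (owf m (name k))])
        (u ++ [ite (disj (S.map fun x => eq m x)) zero (name n)])
  | prfRowf (k n : Name N) (u S : List (Term N)) (m : Term N)
      (hn : Fresh n (u ++ [m])) (hk : OwfKeySafe k (u ++ [m]))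
      (hS : Enumerates (fun x => rowf x (name k)) (u ++ [m]) S) :
      Deriv (u ++ [ite (disj (S.map fun x => eq m x)) zero (rowf m (name k))])
        (u ++ [ite (disj (S.map fun x => eq m x)) zero (name n)])
  | eufMac (j : MacTag) (k : Name N) (s m : Term N) (S : List (Term N))
      (hk : MacKeySafe k [s, m]) (hS : Enumerates (fun x => mac j x (name k)) [s, m] S) :
      Deriv [imp (eq s (mac j m (name k))) (disj (S.map fun x => eq s (mac j x (name k))))] [tt]
  | cr (j : MacTag) (k : Name N) (m₁ m₂ : Term N) (hk : MacKeySafe k [m₁, m₂]) :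
      Deriv [imp (eq (mac j m₁ (name k)) (mac j m₂ (name k))) (eq m₁ m₂)] [tt]

/-- A boolean term holds when `b ∼ true` has a derivation. -/
def Holds {N : ℕ} (b : Term N) : Prop := Deriv [b] [tt]

end Axioms

/-! ## The protocol -/

/-- Action identifiers. -/
inductive Action (N : ℕ) : Type
  /-- reset of the user `ID` -/
  | newSession (ID : Fin N) (j : ℕ) : Action N
  /-- messages 0, 1, 2 of the user session `j` of `ID` in the SUPI sub-protocol -/
  | pu0 (ID : Fin N) (j : ℕ) : Action N
  | pu1 (ID : Fin N) (j : ℕ) : Action N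
  | pu2 (ID : Fin N) (j : ℕ) : Action N
  /-- messages 0, 1 of the user session `j` of `ID` in the GUTI sub-protocol -/
  | tu0 (ID : Fin N) (j : ℕ) : Action N
  | tu1 (ID : Fin N) (j : ℕ) : Action N
  /-- the user message in the GUTI assignment sub-protocol -/
  | fu (ID : Fin N) (j : ℕ) : Action N
  /-- messages 0, 1 of the network session `j` in the SUPI sub-protocol -/
  | pn0 (j : ℕ) : Action N
  | pn1 (j : ℕ) : Action N
  /-- messages 0, 1 of the network session `j` in the GUTI sub-protocol -/
  | tn0 (j : ℕ) : Action N
  | tn1 (j : ℕ) : Action N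
  /-- the network message in the GUTI assignment sub-protocol -/
  | fn (j : ℕ) : Action N

/-- State variables. -/
inductive Var (N : ℕ) : Type
  | sqnUE (ID : Fin N) : Var N
  | sqnHN (a : Agent N) : Var N
  | gutiUE (ID : Fin N) : Var N
  | gutiHN (a : Agent N) : Var N
  /-- end-authentication of the user: the challenge it authenticated -/
  | eAuthUE (ID : Fin N) : Var N
  /-- begin-authentication of the user: the challenge it received -/
  | bAuthUE (ID : Fin N) : Var N
  /-- the identity authenticated by the network session `j` -/
  | eAuthHN (j : ℕ) : Var N
  /-- the identity claimed to the network session `j` -/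
  | bAuthHN (j : ℕ) : Var N
  /-- whether the user had a valid temporary identity when it started the GUTI sub-protocol -/
  | startedGutiUE (ID : Fin N) : Var N
  /-- whether the user has a valid temporary identity -/
  | validGutiUE (ID : Fin N) : Var N
  /-- the challenge of the last relevant network session for `ID` -/
  | sessionHN (ID : Fin N) : Var N
  /-- phantom variable: successful SUPI session since the last reset -/
  | syncUE (ID : Fin N) : Var N

section Protocol

open Term

variable {N : ℕ}

/-- Symbolic states. -/
abbrev State (N : ℕ) : Type := Var N → Term N

/-- The initial symbolic state. -/
def initState : State N
  | .sqnUE ID => sqnInitUE ID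
  | .sqnHN a => sqnInitHN a
  | .gutiUE _ => unset
  | .gutiHN _ => unset
  | .eAuthUE _ => fail
  | .bAuthUE _ => fail
  | .eAuthHN _ => fail
  | .bAuthHN _ => fail
  | .startedGutiUE _ => ff
  | .validGutiUE _ => ff
  | .sessionHN _ => ff
  | .syncUE _ => ff

/-- `if c 0 then x 0 else if c 1 then x 1 else ... else d`, over all the identities. -/
def iteChain (c x : Fin N → Term N) (d : Term N) : Term N :=
  (List.finRange N).foldr (fun ID r => ite (c ID) (x ID) r) d

def key (a : Agent N) : Term N := name (.key a)
def mkey (a : Agent N) : Term N := name (.mkey a)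
def chal (j : ℕ) : Term N := name (.chal j)
def newGuti (j : ℕ) : Term N := name (.guti j)
def pkHN : Term N := pk (name .hn)
def skHN : Term N := sk (name .hn)

/-! In the following definitions, `σ` is the state before the action, and `g` is the input. -/

/-- The encrypted identity and sequence number. -/
def encPU1 (σ : State N) (ID : Fin N) (j : ℕ) : Term N :=
  enc (pair (ident ID) (σ (.sqnUE ID))) pkHN (name (.encRand ID j))

def acceptPU2 (σ : State N) (g : Term N) (ID : Fin N) : Term N :=
  eq g (mac .m2 (pair (σ (.bAuthUE ID)) (σ (.sqnUE ID))) (mkey (some ID)))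

def decPN1 (g : Term N) : Term N := dec (fst g) skHN

def acceptPN1 (g : Term N) (j : ℕ) (ID : Fin N) : Term N :=
  and (eq (snd g) (mac .m1 (pair (fst g) (chal j)) (mkey (some ID))))
    (eq (fst (decPN1 g)) (ident ID))

def incAcceptPN1 (σ : State N) (g : Term N) (j : ℕ) (ID : Fin N) : Term N :=
  and (acceptPN1 g j ID) (geq (snd (decPN1 g)) (σ (.sqnHN (some ID))))

def msgTN0 (σ : State N) (j : ℕ) (a : Agent N) : Term N :=
  triple (chal j) (xor (σ (.sqnHN a)) (owf (chal j) (key a)))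
    (mac .m3 (triple (chal j) (σ (.sqnHN a)) (σ (.gutiHN a))) (mkey a))

def acceptTN0 (σ : State N) (g : Term N) (ID : Fin N) : Term N :=
  and (eq (σ (.gutiHN (some ID))) g) (not (eq (σ (.gutiHN (some ID))) unset))

/-- The sequence number extracted by the user. -/
def sqnTU1 (g : Term N) (ID : Fin N) : Term N :=
  xor (snd g) (owf (fst g) (key (some ID)))

def acceptTU1 (σ : State N) (g : Term N) (ID : Fin N) : Term N :=
  and (eq (thd g) (mac .m3 (triple (fst g) (sqnTU1 g ID) (σ (.gutiUE ID))) (mkey (some ID))))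
    (and (σ (.startedGutiUE ID)) (range (σ (.sqnUE ID)) (sqnTU1 g ID)))

def acceptTN1 (σ : State N) (g : Term N) (j : ℕ) (ID : Fin N) : Term N :=
  and (eq g (mac .m4 (chal j) (mkey (some ID)))) (eq (σ (.bAuthHN j)) (ident ID))

def incAcceptTN1 (σ : State N) (g : Term N) (j : ℕ) (ID : Fin N) : Term N :=
  and (acceptTN1 σ g j ID) (eq (σ (.sessionHN ID)) (chal j))

def msgFN (j : ℕ) (ID : Fin N) : Term N :=
  pair (xor (newGuti j) (rowf (chal j) (key (some ID))))
    (mac .m5 (pair (newGuti j) (chal j)) (mkey (some ID)))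

/-- The temporary identity extracted by the user. -/
def gutiFU (σ : State N) (g : Term N) (ID : Fin N) : Term N :=
  xor (fst g) (rowf (σ (.eAuthUE ID)) (key (some ID)))

def acceptFU (σ : State N) (g : Term N) (ID : Fin N) : Term N :=
  and (eq (snd g) (mac .m5 (pair (gutiFU σ g ID) (σ (.eAuthUE ID))) (mkey (some ID))))
    (and (not (eq (σ (.eAuthUE ID)) fail)) (not (eq (σ (.eAuthUE ID)) bot)))

/-- The message output by an action; `newSession` has no output. -/
def output (σ : State N) (g : Term N) : Action N → List (Term N)
  | .newSession _ _ => []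
  | .pu0 _ _ => [requestChallenge]
  | .pu1 ID j =>
      [pair (encPU1 σ ID j) (mac .m1 (pair (encPU1 σ ID j) g) (mkey (some ID)))]
  | .pu2 ID _ => [ite (acceptPU2 σ g ID) ok error]
  | .tu0 ID _ => [ite (σ (.validGutiUE ID)) (σ (.gutiUE ID)) noGuti]
  | .tu1 ID _ => [ite (acceptTU1 σ g ID) (mac .m4 (fst g) (mkey (some ID))) error]
  | .fu ID _ => [ite (acceptFU σ g ID) ok error]
  | .pn0 j => [chal j]
  | .pn1 j =>
      [iteChain (acceptPN1 g j)
        (fun ID => mac .m2 (pair (chal j) (sqnSuc (snd (decPN1 g)))) (mkey (some ID))) unknownId]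
  | .tn0 j => [iteChain (acceptTN0 σ g) (fun ID => msgTN0 σ j (some ID)) (msgTN0 σ j none)]
  | .tn1 j => [ite (disj ((List.finRange N).map (acceptTN1 σ g j))) ok error]
  | .fn j => [iteChain (fun ID => eq (σ (.eAuthHN j)) (ident ID)) (msgFN j) unknownId]

/-- The symbolic state update of an action, as a partial function. -/
def update (σ : State N) (g : Term N) : Action N → Var N → Option (Term N)
  | .newSession ID _, x => match x with
      | .validGutiUE I => if I = ID then some ff else none
      | .syncUE I => if I = ID then some ff else none
      | _ => none
  | .pu0 _ _, _ => none
  | .pu1 ID _, x => match x with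
      | .sqnUE I => if I = ID then some (sqnSuc (σ (.sqnUE ID))) else none
      | .bAuthUE I => if I = ID then some g else none
      | .eAuthUE I => if I = ID then some fail else none
      | .gutiUE I => if I = ID then some unset else none
      | .validGutiUE I => if I = ID then some ff else none
      | _ => none
  | .pu2 ID _, x => match x with
      | .eAuthUE I =>
          if I = ID then some (ite (acceptPU2 σ g ID) (σ (.bAuthUE ID)) fail) else none
      | .syncUE I => if I = ID then some (or (σ (.syncUE ID)) (acceptPU2 σ g ID)) else none
      | _ => none
  | .tu0 ID _, x => match x with
      | .validGutiUE I => if I = ID then some ff else none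
      | .startedGutiUE I => if I = ID then some (σ (.validGutiUE ID)) else none
      | .eAuthUE I => if I = ID then some fail else none
      | .bAuthUE I => if I = ID then some fail else none
      | _ => none
  | .tu1 ID _, x => match x with
      | .bAuthUE I => if I = ID then some (ite (acceptTU1 σ g ID) (fst g) fail) else none
      | .eAuthUE I => if I = ID then some (ite (acceptTU1 σ g ID) (fst g) fail) else none
      | .sqnUE I =>
          if I = ID then
            some (ite (acceptTU1 σ g ID) (sqnSuc (σ (.sqnUE ID))) (σ (.sqnUE ID)))
          else none
      | _ => none
  | .fu ID _, x => match x with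
      | .validGutiUE I => if I = ID then some (acceptFU σ g ID) else none
      | .gutiUE I => if I = ID then some (ite (acceptFU σ g ID) (gutiFU σ g ID) unset) else none
      | _ => none
  | .pn0 _, _ => none
  | .pn1 j, x => match x with
      | .sessionHN ID => some (ite (incAcceptPN1 σ g j ID) (chal j) (σ (.sessionHN ID)))
      | .gutiHN (some ID) =>
          some (ite (incAcceptPN1 σ g j ID) (newGuti j) (σ (.gutiHN (some ID))))
      | .sqnHN (some ID) =>
          some (ite (incAcceptPN1 σ g j ID) (sqnSuc (snd (decPN1 g))) (σ (.sqnHN (some ID))))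
      | .bAuthHN i => if i = j then some (iteChain (acceptPN1 g j) ident unknownId) else none
      | .eAuthHN i => if i = j then some (iteChain (acceptPN1 g j) ident unknownId) else none
      | _ => none
  | .tn0 j, x => match x with
      | .gutiHN (some ID) => some (ite (acceptTN0 σ g ID) unset (σ (.gutiHN (some ID))))
      | .sessionHN ID => some (ite (acceptTN0 σ g ID) (chal j) (σ (.sessionHN ID)))
      | .bAuthHN i => if i = j then some (iteChain (acceptTN0 σ g) ident unknownId) else none
      | _ => none
  | .tn1 j, x => match x with
      | .sqnHN (some ID) =>
          some (ite (incAcceptTN1 σ g j ID) (sqnSuc (σ (.sqnHN (some ID)))) (σ (.sqnHN (some ID))))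
      | .gutiHN (some ID) =>
          some (ite (incAcceptTN1 σ g j ID) (newGuti j) (σ (.gutiHN (some ID))))
      | .eAuthHN i => if i = j then some (iteChain (acceptTN1 σ g j) ident unknownId) else none
      | _ => none
  | .fn _, _ => none

/-- Executing one action, from a symbolic state and a frame. -/
def step (c : State N × List (Term N)) (a : Action N) : State N × List (Term N) :=
  (fun x => (update c.1 (advInput c.2) a x).getD (c.1 x), c.2 ++ output c.1 (advInput c.2) a)

/-- The symbolic state and the frame after a trace; the initial frame is the public key. -/
def exec (τ : List (Action N)) : State N × List (Term N) :=
  τ.foldl step (initState, [pkHN])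

/-- The symbolic state before the last action of a trace (the initial state if there is none). -/
def stateBefore (τ : List (Action N)) : State N := (exec τ.dropLast).1

/-! ## Valid symbolic traces -/

/-- The identity and the session number of a user action. -/
def Action.userSession : Action N → Option (Fin N × ℕ)
  | .newSession ID j | .pu0 ID j | .pu1 ID j | .pu2 ID j | .tu0 ID j | .tu1 ID j | .fu ID j =>
      some (ID, j)
  | .pn0 _ | .pn1 _ | .tn0 _ | .tn1 _ | .fn _ => none

/-- The identity of a user action. -/
def Action.user (a : Action N) : Option (Fin N) := a.userSession.map Prod.fst

/-- The session number of a network action. -/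
def Action.netSession : Action N → Option ℕ
  | .pn0 j | .pn1 j | .tn0 j | .tn1 j | .fn j => some j
  | .newSession _ _ | .pu0 _ _ | .pu1 _ _ | .pu2 _ _ | .tu0 _ _ | .tu1 _ _ | .fu _ _ => none

/-- The first actions of session `j` of the user `ID`. -/
inductive UserStart (ID : Fin N) (j : ℕ) : Action N → Prop
  | newSession : UserStart ID j (.newSession ID j)
  | pu0 : UserStart ID j (.pu0 ID j)
  | tu0 : UserStart ID j (.tu0 ID j)

/-- Transitions of the user `ID`. -/
inductive UserStep (ID : Fin N) : Action N → Action N → Prop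
  | start {i j : ℕ} {a b : Action N} (hij : i < j) (ha : a.userSession = some (ID, i)) (hb : UserStart ID j b) :
      UserStep ID a b
  | pu01 (j : ℕ) : UserStep ID (.pu0 ID j) (.pu1 ID j)
  | pu12 (j : ℕ) : UserStep ID (.pu1 ID j) (.pu2 ID j)
  | pu2fu (j : ℕ) : UserStep ID (.pu2 ID j) (.fu ID j)
  | tu01 (j : ℕ) : UserStep ID (.tu0 ID j) (.tu1 ID j)
  | tu1fu (j : ℕ) : UserStep ID (.tu1 ID j) (.fu ID j)

/-- Initial actions of the user `ID`.  A run may start with any session; the very first session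
may also start directly with the message 1 of the SUPI sub-protocol. -/
inductive UserInitial (ID : Fin N) : Action N → Prop
  | start {j : ℕ} {a : Action N} (h : UserStart ID j a) : UserInitial ID a
  | pu1 : UserInitial ID (.pu1 ID 0)

/-- Transitions of the network session `j`. -/
inductive NetStep (j : ℕ) : Action N → Action N → Prop
  | pn01 : NetStep j (.pn0 j) (.pn1 j)
  | pn1fn : NetStep j (.pn1 j) (.fn j)
  | tn01 : NetStep j (.tn0 j) (.tn1 j)
  | tn1fn : NetStep j (.tn1 j) (.fn j)

/-- Initial actions of the network session `j`. -/
inductive NetInitial (j : ℕ) : Action N → Prop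
  | pn0 : NetInitial j (.pn0 j)
  | tn0 : NetInitial j (.tn0 j)

/-- `w` is a (possibly empty) run with the given initial states and transitions. -/
def IsRun (initial : Action N → Prop) (trans : Action N → Action N → Prop)
    (w : List (Action N)) : Prop :=
  (∀ a ∈ w.head?, initial a) ∧ w.IsChain trans

/-- Valid symbolic traces: interleavings of runs of the users and of the network sessions, such
that a network session is opened only once the previous one has been. -/
structure ValidTrace (τ : List (Action N)) : Prop where
  user : ∀ ID : Fin N,
    IsRun (UserInitial ID) (UserStep ID) (τ.filter fun a => a.user = some ID)
  net : ∀ j : ℕ, IsRun (NetInitial j) (NetStep j) (τ.filter fun a => a.netSession = some j)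
  order : ∀ (j i : ℕ) (hi : i < τ.length), 0 < i → (τ[i]).netSession = some (j + 1) →
    ∃ (i₀ : ℕ) (h₀ : i₀ < i), (τ[i₀]'(h₀.trans hi)).netSession = some j

/-! ## Authentication -/

/-- The end-authentication variable of `ID` is neither `fail` nor `bot`: the user `ID`
authenticated the network. -/
def sucAuth (τ : List (Action N)) (ID : Fin N) : Term N :=
  and (not (eq (stateBefore τ (.eAuthUE ID)) fail)) (not (eq (stateBefore τ (.eAuthUE ID)) bot))

/-- The network session `j` has recorded `ID` as the claimed identity, and its challenge is the one
that the user `ID` authenticated. -/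
def auth (τ : List (Action N)) (ID : Fin N) (j : ℕ) : Term N :=
  and (eq (stateBefore τ (.bAuthHN j)) (ident ID)) (eq (chal j) (stateBefore τ (.eAuthUE ID)))

/-- Among the network sessions in `J`, the session `j` matches the user `ID`, and no other does. -/
def injAuth (τ : List (Action N)) (ID : Fin N) (J : List ℕ) (j : ℕ) : Term N :=
  and (auth τ ID j) (conj ((J.filter (· ≠ j)).map fun i => not (auth τ ID i)))

end Protocol

end AKA

namespace AKA

open Term

section Congruence

variable {N : ℕ}

/-! ## Equality up to negligible probability is a congruence -/

/-! A user stores a challenge in its end-authentication variable only after checking a `Mac²` or a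
`Mac³` under its own integrity key. Users themselves send only `Mac¹` and `Mac⁴`. The network sends
a `Mac²` or `Mac³` under the key of an identity only in the branch of a conditional chain whose twin
stores that identity in `bAuthHN`, and the message then starts with the challenge of that session.
Unforgeability and collision resistance therefore force the accepted challenge to be that of a
session which recorded the user. A session writes its record only once, so the record is still there
later; independence of names makes the session unique.

The difficulty is that EUF-MAC is syntactic: its disjunction ranges over every `Mac` subterm,
including those in the tests made by users and in branches that are not taken. The argument is
therefore made in two-valued models. Derivable equality `DEq` is a congruence; if `b` is not
derivably true, Zorn's lemma gives a congruence maximal among those that do not identify `b` with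
`tt`, and maximality makes it decide every condition. Hence it suffices to verify `b` in every model
(`holds_of_forall_isModel`).

In a model each conditional equals the branch taken, so conditions and dead branches disappear:
every message, and every stored value that is not a mere flag, equals a `Clean` term, in which each
`Mac²` or `Mac³` under a user's key is an honest one (`tame_exec`). The cryptographic rules are
applied to the clean representatives (`Tame.exists_honestMac`), which gives `eAuthUE_exec`;
`Recorded.exec_bAuthHN` carries the record to the end of the trace. -/

theorem Deriv.of_rotate_one {u v : List (Term N)} (hlen : u.length = v.length)
    (h : Deriv (u.rotate 1) (v.rotate 1)) : Deriv u v := by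
  obtain ⟨n, x, rfl⟩ : ∃ n, ∃ x : Fin n → Term N, u = List.ofFn x :=
    ⟨u.length, u.get, (List.ofFn_get u).symm⟩
  obtain ⟨y, rfl⟩ : ∃ y : Fin n → Term N, v = List.ofFn y := by
    simp only [List.length_ofFn] at hlen
    subst hlen
    exact ⟨v.get, (List.ofFn_get v).symm⟩
  have key : ∀ z : Fin n → Term N,
      (List.ofFn z).rotate 1 = List.ofFn (fun i => z (finRotate n i)) := by
    intro z
    apply List.ext_getElem
    · simp
    · intro i h₁ h₂
      simp only [List.length_rotate, List.length_ofFn] at h₁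
      cases n with
      | zero => omega
      | succ n =>
        simp only [List.getElem_rotate, List.getElem_ofFn, List.length_ofFn, finRotate_apply]
        congr 1
        ext
        simp [Fin.val_add]
  rw [key, key] at h
  exact Deriv.perm x y _ h

theorem Deriv.of_rotate {u v : List (Term N)} (hlen : u.length = v.length) (k : ℕ)
    (h : Deriv (u.rotate k) (v.rotate k)) : Deriv u v := by
  induction k generalizing u v with
  | zero => simpa using h
  | succ k ih =>
    apply Deriv.of_rotate_one hlen
    apply ih (by simpa using hlen)
    simpa [List.rotate_rotate, Nat.add_comm] using h

/-- Simultaneous exchange of two blocks. -/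
theorem Deriv.append_swap {u v u' v' : List (Term N)} (hu : u.length = u'.length)
    (hv : v.length = v'.length) (h : Deriv (u ++ v) (u' ++ v')) : Deriv (v ++ u) (v' ++ u') := by
  apply Deriv.of_rotate (by simp [hu, hv]) v.length
  rw [List.rotate_append_length_eq, hv, List.rotate_append_length_eq]
  exact h

/-- `s ≐ t`. -/
def DEq (s t : Term N) : Prop := Deriv [eq s t] [tt]

/-- The rule `rewrite` acts on the last term only, so the tail `l` is first moved in front of the
term to be replaced, and moved back afterwards. -/
theorem Deriv.replace {s t : Term N} (h : DEq s t) (p l : List (Term N)) :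
    Deriv (p ++ s :: l) (p ++ t :: l) := by
  have h₁ : Deriv ((l ++ p) ++ [t]) ((l ++ p) ++ [s]) := Deriv.rewrite (Deriv.refl _) h
  rw [List.append_assoc, List.append_assoc] at h₁
  have h₂ := Deriv.append_swap rfl (by simp) h₁
  simpa using h₂.symm

theorem Deriv.of_forall₂ {l l' : List (Term N)} (h : List.Forall₂ DEq l l') (p : List (Term N)) :
    Deriv (p ++ l) (p ++ l') := by
  induction h generalizing p with
  | nil => exact Deriv.refl _
  | @cons a b l l' hab _ ih =>
    refine Deriv.trans ?_ (Deriv.replace hab p l')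
    simpa using ih (p ++ [a])

/-- The axiom `eqRefl` yields `eq (eq s s) tt ∼ tt`, one level too high; one use of `rewrite` on the
trivial derivation brings it down. -/
theorem DEq.rfl (s : Term N) : DEq s s :=
  (Deriv.rewrite (u := []) (Deriv.refl [eq s s]) (Deriv.eqAx (.eqRefl s))).symm

theorem DEq.rw_symm {s t : Term N} (h : DEq s t) : Deriv [t] [s] :=
  Deriv.rewrite (u := []) (Deriv.refl _) h

theorem DEq.congr_eq {s s' t t' : Term N} (h₁ : DEq s s') (h₂ : DEq t t') :
    Deriv [eq s t] [eq s' t'] := by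
  refine Deriv.fa .eq ![s, t] ![s', t'] (y := []) (y' := []) ?_
  have := Deriv.of_forall₂ (.cons h₁ (.cons h₂ .nil)) []
  simpa using this

theorem DEq.symm {s t : Term N} (h : DEq s t) : DEq t s := by
  have h₁ : Deriv [eq t s] [eq t t] := DEq.congr_eq (DEq.rfl t) h
  exact h₁.trans (DEq.rfl t)

theorem DEq.trans {s t r : Term N} (h₁ : DEq s t) (h₂ : DEq t r) : DEq s r :=
  (DEq.congr_eq (DEq.rfl s) h₂.symm).trans h₁

theorem DEq.ofAx {s t : Term N} (h : EqAx s t) : DEq s t := Deriv.eqAx h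

/-- The rule `fa` acts on the front block only. A copy of `b` is carried along on both sides, so
that one application of `fa` per block, with a swap in between, leads to `f b, f a ∼ f b, f b`;
applying `eq` then reduces the claim to reflexivity. -/
theorem DEq.congr (f : Sym N) {a b : Fin f.arity → Term N} (h : ∀ i, DEq (a i) (b i)) :
    DEq (app f a) (app f b) := by
  have key : ∀ l l' p : List (Term N), l.length = l'.length → List.Forall₂ DEq l l' →
      Deriv (l ++ p) (l' ++ p) := by
    intro l l' p hl h
    exact Deriv.append_swap _root_.rfl hl (Deriv.of_forall₂ h p)
  have hab : List.Forall₂ DEq (List.ofFn a) (List.ofFn b) := by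
    rw [List.forall₂_iff_get]
    exact ⟨by simp, fun i h₁ h₂ => by simpa using h ⟨i, by simpa using h₁⟩⟩
  have h₁ : Deriv (List.ofFn a ++ List.ofFn b) (List.ofFn b ++ List.ofFn b) :=
    key _ _ _ (by simp) hab
  have h₂ : Deriv ([app f a] ++ List.ofFn b) ([app f b] ++ List.ofFn b) := Deriv.fa f a b h₁
  have h₃ := Deriv.append_swap (by simp) (by simp) h₂
  have h₄ : Deriv ([app f b] ++ [app f a]) ([app f b] ++ [app f b]) := Deriv.fa f b b h₃
  have h₅ := Deriv.append_swap (by simp) (by simp) h₄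
  have h₆ : Deriv [eq (app f a) (app f b)] [eq (app f b) (app f b)] :=
    Deriv.fa .eq ![app f a, app f b] ![app f b, app f b] (y := []) (y' := []) (by simpa using h₅)
  exact h₆.trans (DEq.rfl _)

/-- A boolean term holds if and only if it equals `true`. -/
theorem holds_iff_dEq {b : Term N} : Holds b ↔ DEq b tt := by
  constructor
  · intro h
    -- As `tt` is a nullary symbol, `fa` puts it in front of both sides for free.
    have h₁ : Deriv ([tt] ++ [b]) ([tt] ++ [tt]) :=
      Deriv.fa .tt _ _ (y := [b]) (y' := [tt]) (by simpa [Holds] using h)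
    have h₂ := Deriv.append_swap (by simp) (by simp) h₁
    have h₃ : Deriv [eq b tt] [eq tt tt] :=
      Deriv.fa .eq ![b, tt] ![tt, tt] (y := []) (y' := []) (by simpa using h₂)
    exact h₃.trans (DEq.rfl _)
  · intro h
    exact h.rw_symm.symm

end Congruence

section Models

variable {N : ℕ}

/-! ## Congruences and two-valued models -/

/-- A congruence of the term algebra that contains all the derivable equalities. -/
structure IsTheory (r : Term N → Term N → Prop) : Prop where
  equiv : Equivalence r
  congr_update : ∀ (f : Sym N) (a : Fin f.arity → Term N) (i : Fin f.arity) (s t : Term N),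
    r s t → r (app f (Function.update a i s)) (app f (Function.update a i t))
  of_dEq : ∀ s t : Term N, DEq s t → r s t

theorem isTheory_dEq : IsTheory (DEq (N := N)) where
  equiv := ⟨DEq.rfl, DEq.symm, DEq.trans⟩
  congr_update f a i s t h := by
    refine DEq.congr f fun j => ?_
    by_cases hj : j = i
    · subst hj; simpa using h
    · simpa [hj] using DEq.rfl (a j)
  of_dEq _ _ h := h

/-- Conditionals commute with every function symbol, including the conditional. -/
theorem dEq_ite_hom (f : Sym N) (a : Fin f.arity → Term N) (i : Fin f.arity) (b x y : Term N) :
    DEq (app f (Function.update a i (ite b x y)))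
      (ite b (app f (Function.update a i x)) (app f (Function.update a i y))) := by
  by_cases hf : f = .ite
  · subst hf
    have e₀ : ∀ z, app .ite (Function.update a (0 : Fin 3) z) = ite z (a 1) (a 2) := by
      intro z
      rw [Term.ite]; congr 1; ext j; fin_cases j <;> rfl
    have e₁ : ∀ z, app .ite (Function.update a (1 : Fin 3) z) = ite (a 0) z (a 2) := by
      intro z
      rw [Term.ite]; congr 1; ext j; fin_cases j <;> rfl
    have e₂ : ∀ z, app .ite (Function.update a (2 : Fin 3) z) = ite (a 0) (a 1) z := by
      intro z
      rw [Term.ite]; congr 1; ext j; fin_cases j <;> rfl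
    obtain rfl | rfl | rfl : i = (0 : Fin 3) ∨ i = (1 : Fin 3) ∨ i = (2 : Fin 3) :=
      (by decide : ∀ i : Fin 3, i = 0 ∨ i = 1 ∨ i = 2) i
    · rw [e₀, e₀, e₀]; exact .ofAx (.iteIte _ _ _ _ _)
    · rw [e₁, e₁, e₁]; exact .ofAx (.iteSwapThen _ _ _ _ _)
    · rw [e₂, e₂, e₂]; exact .ofAx (.iteSwapElse _ _ _ _ _)
  · exact .ofAx (.iteHom f hf a i b x y)

namespace IsTheory

variable {r : Term N → Term N → Prop}

theorem rfl' (h : IsTheory r) {s : Term N} : r s s := h.equiv.refl s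

theorem ax (h : IsTheory r) {s t : Term N} (e : EqAx s t) : r s t := h.of_dEq _ _ (.ofAx e)

/-- The arguments are changed one at a time; `s` is the set of positions already changed. The
one-argument form is the primitive one because the laws of conditionals move a conditional out of a
single argument. -/
theorem congr (h : IsTheory r) (f : Sym N) {a b : Fin f.arity → Term N} (hab : ∀ i, r (a i) (b i)) :
    r (app f a) (app f b) := by
  have key : ∀ s : Finset (Fin f.arity), r (app f a) (app f (s.piecewise b a)) := by
    intro s
    induction s using Finset.induction_on with
    | empty => simpa using h.rfl'
    | insert j s hj ih =>
      refine h.equiv.trans ih ?_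
      rw [Finset.piecewise_insert]
      have e : s.piecewise b a = Function.update (s.piecewise b a) j (a j) := by
        conv_lhs => rw [← Function.update_eq_self j (s.piecewise b a)]
        rw [Finset.piecewise_eq_of_notMem _ _ _ hj]
      conv_lhs => rw [e]
      exact h.congr_update f _ j _ _ (hab j)
  simpa using key Finset.univ

theorem congr_ite (h : IsTheory r) {b b' x x' y y' : Term N} (h₀ : r b b') (h₁ : r x x')
    (h₂ : r y y') : r (ite b x y) (ite b' x' y') := by
  refine h.congr .ite fun i => ?_
  revert i
  simp only [Fin.forall_fin_succ]
  exact ⟨h₀, h₁, h₂, fun i => i.elim0⟩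

/-- Adding the hypothesis `c` to a theory. -/
theorem assume_then (h : IsTheory r) (c : Term N) :
    IsTheory (fun s t => ∀ z, r (ite c s z) (ite c t z)) where
  equiv := ⟨fun _ _ => h.rfl', fun e z => h.equiv.symm (e z), fun e e' z => h.equiv.trans (e z) (e' z)⟩
  of_dEq s t e z := h.congr_ite h.rfl' (h.of_dEq _ _ e) h.rfl'
  congr_update f a i s t e z := by
    -- The hypothesis is used with `z := t`, so that its right side collapses under `f`. Pulling the
    -- conditional out of `f` gives the equality with `app f (… t)` in the else branch; `iteThen`
    -- then replaces that branch by any `z`.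
    have h₁ := h.congr_update f a i _ _ (e t)
    have h₂ := h.equiv.trans (h.equiv.symm (h.of_dEq _ _ (dEq_ite_hom f a i c s t)))
      (h.equiv.trans h₁ (h.of_dEq _ _ (dEq_ite_hom f a i c t t)))
    have h₃ := h.congr_ite (b := c) h.rfl' h₂ (h.rfl' (s := z))
    exact h.equiv.trans (h.equiv.symm (h.ax (.iteThen _ _ _ _)))
      (h.equiv.trans h₃ (h.ax (.iteThen _ _ _ _)))

/-- Adding the negation of the hypothesis `c` to a theory. -/
theorem assume_else (h : IsTheory r) (c : Term N) :
    IsTheory (fun s t => ∀ z, r (ite c z s) (ite c z t)) where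
  equiv := ⟨fun _ _ => h.rfl', fun e z => h.equiv.symm (e z), fun e e' z => h.equiv.trans (e z) (e' z)⟩
  of_dEq s t e z := h.congr_ite h.rfl' h.rfl' (h.of_dEq _ _ e)
  congr_update f a i s t e z := by
    have h₁ := h.congr_update f a i _ _ (e t)
    have h₂ := h.equiv.trans (h.equiv.symm (h.of_dEq _ _ (dEq_ite_hom f a i c t s)))
      (h.equiv.trans h₁ (h.of_dEq _ _ (dEq_ite_hom f a i c t t)))
    have h₃ := h.congr_ite (b := c) h.rfl' (h.rfl' (s := z)) h₂
    exact h.equiv.trans (h.equiv.symm (h.ax (.iteElse _ _ _ _)))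
      (h.equiv.trans h₃ (h.ax (.iteElse _ _ _ _)))

theorem sUnion {c : Set (Term N → Term N → Prop)} (hc : IsChain (· ≤ ·) c) (hne : c.Nonempty)
    (h : ∀ r ∈ c, IsTheory r) : IsTheory (fun s t => ∃ r ∈ c, r s t) where
  equiv := by
    obtain ⟨r₀, hr₀⟩ := hne
    refine ⟨fun s => ⟨r₀, hr₀, (h r₀ hr₀).rfl'⟩, ?_, ?_⟩
    · rintro s t ⟨r, hr, e⟩
      exact ⟨r, hr, (h r hr).equiv.symm e⟩
    · rintro s t u ⟨r, hr, e⟩ ⟨r', hr', e'⟩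
      rcases hc.total hr hr' with hle | hle
      · exact ⟨r', hr', (h r' hr').equiv.trans (hle _ _ e) e'⟩
      · exact ⟨r, hr, (h r hr).equiv.trans e (hle _ _ e')⟩
  congr_update f a i s t := by
    rintro ⟨r, hr, e⟩
    exact ⟨r, hr, (h r hr).congr_update f a i s t e⟩
  of_dEq s t e := by
    obtain ⟨r₀, hr₀⟩ := hne
    exact ⟨r₀, hr₀, (h r₀ hr₀).of_dEq s t e⟩

end IsTheory

/-- A model: a nontrivial theory in which every condition is either true or false. -/
structure IsModel (r : Term N → Term N → Prop) : Prop extends IsTheory r where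
  cases : ∀ c, (∀ x y, r (ite c x y) x) ∨ (∀ x y, r (ite c x y) y)
  nontrivial : ∃ s t, ¬ r s t

/-- A boolean term that is true in all the models holds. -/
theorem holds_of_forall_isModel {b : Term N}
    (h : ∀ r : Term N → Term N → Prop, IsModel r → r b tt) : Holds b := by
  rw [holds_iff_dEq]
  by_contra hb
  -- `m` is maximal among the theories that do not identify `b` with `tt`; the chain bound is the
  -- union.
  obtain ⟨m, -, hm⟩ := zorn_le_nonempty₀ {r : Term N → Term N → Prop | IsTheory r ∧ ¬ r b tt}
    (fun c hcs hc y hy => ⟨fun s t => ∃ r ∈ c, r s t,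
      ⟨IsTheory.sUnion hc ⟨y, hy⟩ fun r hr => (hcs hr).1, by
        rintro ⟨r, hr, e⟩
        exact (hcs hr).2 e⟩,
      fun r hr s t e => ⟨r, hr, e⟩⟩)
    DEq ⟨isTheory_dEq, hb⟩
  have hT : IsTheory m := hm.prop.1
  refine hm.prop.2 (h m { toIsTheory := hT, cases := fun c => ?_, nontrivial := ⟨_, _, hm.prop.2⟩ })
  -- The equality of `b` and `tt` cannot follow both from `c` and from its negation, since `iteSame`
  -- would then give it outright. So one of the two extensions still separates them, and by
  -- maximality it adds nothing to `m`: the condition is already decided there.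
  by_cases h₁ : ∀ z, m (ite c b z) (ite c tt z)
  · right
    have hle := hm.le_of_ge (y := fun s t => ∀ z, m (ite c z s) (ite c z t))
      ⟨hT.assume_else c, fun h₂ => hm.prop.2 ?_⟩
      (fun s t e z => hT.congr_ite hT.rfl' hT.rfl' e)
    · exact fun x y => hle _ _ fun z => hT.ax (.iteElse _ _ _ _)
    · exact hT.equiv.trans (hT.equiv.symm (hT.ax (.iteSame c b)))
        (hT.equiv.trans (h₁ b) (hT.equiv.trans (h₂ tt) (hT.ax (.iteSame c tt))))
  · left
    have hle := hm.le_of_ge (y := fun s t => ∀ z, m (ite c s z) (ite c t z))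
      ⟨hT.assume_then c, h₁⟩ (fun s t e z => hT.congr_ite hT.rfl' e hT.rfl')
    exact fun x y => hle _ _ fun z => hT.ax (.iteThen _ _ _ _)

end Models

/-! ### Truth values in a model -/

section Models

variable {N : ℕ}

/-- This turns a true equation of a model into an actual identification. Comparing the conditional
with `t` and moving `eq` inside leaves `eq s t → eq s t`, an instance of a valid arithmetic formula,
whatever the terms `s` and `t` are. -/
theorem dEq_ite_eq (s t : Term N) : DEq (ite (eq s t) s t) t := by
  have hself : DEq (ite (eq s t) (eq s t) tt) tt :=
    .ofAx (.arith (.imp (.eq (.var 0) (.var 1)) (.eq (.var 0) (.var 1))) (fun _ h => h)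
      (fun i => if i = 0 then s else t))
  have hhom := dEq_ite_hom .eq ![s, t] 0 (eq s t) s t
  have e : ∀ z, app (N := N) .eq (Function.update ![s, t] (0 : Fin 2) z) = eq z t := by
    intro z
    rw [Term.eq]; congr 1; ext j; fin_cases j <;> rfl
  rw [e, e, e] at hhom
  exact holds_iff_dEq.2 <| hhom.trans <|
    (isTheory_dEq.congr_ite (DEq.rfl _) (DEq.rfl _) (.ofAx (.eqRefl t))).trans hself

/-- The condition `c` is true in the model `r`. -/
def IsTrue (r : Term N → Term N → Prop) (c : Term N) : Prop := ∀ x y, r (ite c x y) x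

namespace IsModel

variable {r : Term N → Term N → Prop}

theorem ite_else (h : IsModel r) {c : Term N} (hc : ¬ IsTrue r c) (x y : Term N) :
    r (ite c x y) y :=
  ((h.cases c).resolve_left hc) x y

theorem symm (h : IsModel r) {s t : Term N} (e : r s t) : r t s := h.equiv.symm e

theorem trans (h : IsModel r) {s t u : Term N} (e : r s t) (e' : r t u) : r s u :=
  h.equiv.trans e e'

theorem not_tt_ff (h : IsModel r) : ¬ r tt ff := by
  intro e
  obtain ⟨s, t, hst⟩ := h.nontrivial
  exact hst <| h.trans (h.symm (h.ax (.iteTrue s t)))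
    (h.trans (h.congr_ite e h.rfl' h.rfl') (h.ax (.iteFalse s t)))

theorem isTrue_congr (h : IsModel r) {c c' : Term N} (e : r c c') : IsTrue r c ↔ IsTrue r c' :=
  ⟨fun hc x y => h.trans (h.congr_ite (h.symm e) h.rfl' h.rfl') (hc x y),
    fun hc x y => h.trans (h.congr_ite e h.rfl' h.rfl') (hc x y)⟩

theorem isTrue_tt (h : IsModel r) : IsTrue r tt := fun x y => h.ax (.iteTrue x y)

theorem not_isTrue_ff (h : IsModel r) : ¬ IsTrue r ff := fun hf =>
  h.not_tt_ff (h.trans (h.symm (hf tt ff)) (h.ax (.iteFalse tt ff)))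

theorem isTrue_of_tt (h : IsModel r) {c : Term N} (e : r c tt) : IsTrue r c :=
  (h.isTrue_congr e).2 h.isTrue_tt

theorem congr_fst (h : IsModel r) {s t : Term N} (e : r s t) : r (fst s) (fst t) :=
  h.congr .fst (by simpa [Fin.forall_fin_succ] using e)

theorem congr_eq (h : IsModel r) {s t s' t' : Term N} (e : r s s') (e' : r t t') :
    r (eq s t) (eq s' t') :=
  h.congr .eq (by simpa [Fin.forall_fin_succ] using ⟨e, e'⟩)

theorem congr_mac (h : IsModel r) (j : MacTag) {s t s' t' : Term N} (e : r s s') (e' : r t t') :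
    r (mac j s t) (mac j s' t') :=
  h.congr (.mac j) (by simpa [Fin.forall_fin_succ] using ⟨e, e'⟩)

theorem isTrue_imp (h : IsModel r) {b c : Term N} :
    IsTrue r (imp b c) ↔ (IsTrue r b → IsTrue r c) := by
  by_cases hb : IsTrue r b
  · simp only [hb, true_imp_iff]
    exact h.isTrue_congr (hb c tt)
  · simp only [hb, false_imp_iff, iff_true]
    exact h.isTrue_of_tt (h.ite_else hb c tt)

theorem isTrue_and (h : IsModel r) {b c : Term N} :
    IsTrue r (and b c) ↔ IsTrue r b ∧ IsTrue r c := by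
  by_cases hb : IsTrue r b
  · simp only [hb, true_and]
    exact h.isTrue_congr (hb c ff)
  · simp only [hb, false_and, iff_false]
    exact fun hbc => h.not_isTrue_ff ((h.isTrue_congr (h.ite_else hb c ff)).1 hbc)

theorem isTrue_not (h : IsModel r) {b : Term N} : IsTrue r (not b) ↔ ¬ IsTrue r b := by
  by_cases hb : IsTrue r b
  · simp only [hb, not_true_eq_false, iff_false]
    exact fun hbc => h.not_isTrue_ff ((h.isTrue_congr (hb ff tt)).1 hbc)
  · simp only [hb, not_false_eq_true, iff_true]
    exact h.isTrue_of_tt (h.ite_else hb ff tt)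

theorem isTrue_eq (h : IsModel r) {s t : Term N} : IsTrue r (eq s t) ↔ r s t := by
  constructor
  · intro he
    exact h.trans (h.symm (he s t)) (h.of_dEq _ _ (dEq_ite_eq s t))
  · intro e
    exact h.isTrue_of_tt (h.trans (h.congr_eq e h.rfl') (h.ax (.eqRefl t)))

/-- A disjunction with a true member equals `true`. -/
theorem disj_tt (h : IsModel r) {l : List (Term N)} (hl : ∃ b ∈ l, IsTrue r b) : r (disj l) tt := by
  induction l with
  | nil => simp at hl
  | cons b l ih =>
    change r (ite b tt (disj l)) tt
    by_cases hb : IsTrue r b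
    · exact hb _ _
    · refine h.trans (h.ite_else hb _ _) (ih ?_)
      obtain ⟨c, hc, hc'⟩ := hl
      rcases List.mem_cons.1 hc with rfl | hc
      · exact absurd hc' hb
      · exact ⟨c, hc, hc'⟩

/-- Holding requires equality with `tt`, which `IsTrue` does not give at once, because no axiom
identifies `ite b tt ff` with `b`. Implications and disjunctions have a literal `tt` as a branch,
which supplies it. -/
theorem imp_tt (h : IsModel r) {b c : Term N} (hbc : IsTrue r b → r c tt) : r (imp b c) tt := by
  by_cases hb : IsTrue r b
  · exact h.trans (hb c tt) (hbc hb)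
  · exact h.ite_else hb c tt

theorem exists_of_isTrue_disj (h : IsModel r) {l : List (Term N)} (hl : IsTrue r (disj l)) :
    ∃ b ∈ l, IsTrue r b := by
  induction l with
  | nil => exact absurd hl h.not_isTrue_ff
  | cons b l ih =>
    by_cases hb : IsTrue r b
    · exact ⟨b, by simp, hb⟩
    · obtain ⟨c, hc, hc'⟩ := ih ((h.isTrue_congr (h.ite_else hb tt (disj l))).1 hl)
      exact ⟨c, by simp [hc], hc'⟩

theorem isTrue_conj (h : IsModel r) {l : List (Term N)} (hl : ∀ b ∈ l, IsTrue r b) :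
    IsTrue r (conj l) := by
  induction l with
  | nil => exact h.isTrue_tt
  | cons b l ih =>
    exact h.isTrue_and.2 ⟨hl b (by simp), ih fun c hc => hl c (by simp [hc])⟩

end IsModel

end Models

section Honest

variable {N : ℕ}

/-! ## Honestly built terms -/

theorem mac_inj {j j' : MacTag} {x x' k k' : Term N} (h : mac j x k = mac j' x' k') :
    j = j' ∧ x = x' ∧ k = k' := by
  simp only [mac, app.injEq, Sym.mac.injEq] at h
  obtain ⟨rfl, h⟩ := h
  have h := eq_of_heq h
  exact ⟨rfl, congrFun h 0, congrFun h 1⟩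

/-- If `R i ID` means that the network session `i` recorded the identity `ID`, this is what is known
of the messages that the network authenticates with the key of `ID`. -/
def HonestMac (r : Term N → Term N → Prop) (R : ℕ → Fin N → Prop) (j : MacTag) (x : Term N)
    (a : Agent N) : Prop :=
  ∀ ID, a = some ID → (j = .m2 ∨ j = .m3) → ∃ i, R i ID ∧ r (fst x) (chal i)

/-- Terms in which the integrity keys are used only to authenticate honest messages. -/
inductive Clean (r : Term N → Term N → Prop) (R : ℕ → Fin N → Prop) : Term N → Prop
  | name (n : Name N) (hn : ∀ a, n ≠ .mkey a) : Clean r R (name n)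
  | app (f : Sym N) (hf : ∀ j, f ≠ .mac j) (a : Fin f.arity → Term N)
      (ha : ∀ i, Clean r R (a i)) : Clean r R (app f a)
  | mac (j : MacTag) (x : Term N) (a : Agent N) (hx : Clean r R x)
      (h : HonestMac r R j x a) : Clean r R (mac j x (mkey a))

namespace Clean

variable {r : Term N → Term N → Prop} {R R' : ℕ → Fin N → Prop}

theorem mono (hR : ∀ i ID, R i ID → R' i ID) {t : Term N} (ht : Clean r R t) : Clean r R' t := by
  induction ht with
  | name n hn => exact .name n hn
  | app f hf a _ ih => exact .app f hf a ih
  | mac j x a _ h ih =>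
    refine .mac j x a ih fun ID ha hj => ?_
    obtain ⟨i, hi, e⟩ := h ID ha hj
    exact ⟨i, hR _ _ hi, e⟩

/-- This is the side condition on keys in `eufMac` and `cr`: an integrity key can enter a clean term
only through the constructor `mac`. -/
theorem onlyAt {t : Term N} (ht : Clean r R t) (b : Agent N) :
    OnlyAt (.name (.mkey b)) IsMacKeyPos t := by
  induction ht with
  | name n hn => simpa [OnlyAt] using (hn b).symm
  | app f hf a _ ih => exact ⟨by simp, fun i => .inr (ih i)⟩
  | mac j x a _ h ih =>
    refine ⟨by simp, ?_⟩
    simp only [Fin.forall_fin_succ]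
    refine ⟨.inr ih, ?_, fun i => i.elim0⟩
    by_cases hab : a = b
    · subst hab; exact .inl ⟨_root_.rfl, _root_.rfl⟩
    · right; simpa [OnlyAt, mkey] using fun h => hab h.symm

theorem of_isSubterm {t x : Term N} {j : MacTag} {a : Agent N} (ht : Clean r R t)
    (hs : IsSubterm (Term.mac j x (mkey a)) t) : Clean r R x ∧ HonestMac r R j x a := by
  induction ht with
  | name n hn => simp [IsSubterm, Term.mac] at hs
  | app f hf b _ ih =>
    rcases hs with hs | ⟨i, hs⟩
    · simp only [Term.mac, app.injEq] at hs
      exact absurd hs.1.symm (hf j)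
    · exact ih i hs
  | mac j' x' a' hx h ih =>
    rcases hs with hs | ⟨i, hs⟩
    · obtain ⟨rfl, rfl, e⟩ := mac_inj hs
      simp only [mkey, name.injEq, Name.mkey.injEq] at e
      subst e
      exact ⟨hx, h⟩
    · revert i
      simp only [Fin.forall_fin_succ]
      exact ⟨ih, fun hs => by simp [IsSubterm, Term.mac, mkey] at hs, fun i => i.elim0⟩

end Clean

/-- The messages authenticated in a term can be listed. -/
theorem exists_enumerates_mac (j : MacTag) (k t : Term N) :
    ∃ S : List (Term N), ∀ m, m ∈ S ↔ IsSubterm (mac j m k) t := by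
  induction t with
  | name n => exact ⟨[], fun m => by simp [IsSubterm, mac]⟩
  | app f a ih =>
    choose S hS using ih
    obtain ⟨S₀, hS₀⟩ : ∃ S₀ : List (Term N), ∀ m, m ∈ S₀ ↔ mac j m k = app f a := by
      by_cases h : ∃ m, mac j m k = app f a
      · obtain ⟨m, hm⟩ := h
        refine ⟨[m], fun m' => ?_⟩
        rw [List.mem_singleton, ← hm]
        exact ⟨fun e => by rw [e], fun e => (mac_inj e).2.1⟩
      · exact ⟨[], fun m => by simpa using fun e => h ⟨m, e⟩⟩
    refine ⟨S₀ ++ (List.ofFn S).flatten, fun m => ?_⟩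
    simp [IsSubterm, hS₀, List.mem_flatten, List.mem_ofFn, hS]

/-- Terms that are equal, in the model `r`, to a clean term. -/
def Tame (r : Term N → Term N → Prop) (R : ℕ → Fin N → Prop) (t : Term N) : Prop :=
  ∃ t', r t t' ∧ Clean r R t'

namespace Tame

variable {r : Term N → Term N → Prop} {R R' : ℕ → Fin N → Prop}

theorem mono (hR : ∀ i ID, R i ID → R' i ID) {t : Term N} (ht : Tame r R t) : Tame r R' t :=
  let ⟨t', e, h⟩ := ht; ⟨t', e, h.mono hR⟩

theorem of_rel (hr : IsModel r) {s t : Term N} (e : r s t) (ht : Tame r R t) : Tame r R s :=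
  let ⟨t', e', h⟩ := ht; ⟨t', hr.trans e e', h⟩

theorem name (hr : IsModel r) (n : Name N) (hn : ∀ a, n ≠ .mkey a) : Tame r R (name n) :=
  ⟨_, hr.rfl', .name n hn⟩

theorem app (hr : IsModel r) (f : Sym N) (hf : ∀ j, f ≠ .mac j) (a : Fin f.arity → Term N)
    (ha : ∀ i, Tame r R (a i)) : Tame r R (app f a) := by
  choose b hb hb' using ha
  exact ⟨_, hr.congr f hb, .app f hf b hb'⟩

theorem cst (hr : IsModel r) (f : Sym N) (h : f.arity = 0) : Tame r R (cst f h) :=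
  app hr f (by rintro j rfl; cases h) _ fun i => (Fin.cast h i).elim0

/-- Nothing is asked of the condition `c`, and each branch is considered only when it is taken. This
is how the verification tests and the dead branches are discarded. -/
theorem ite (hr : IsModel r) {c x y : Term N} (hx : IsTrue r c → Tame r R x)
    (hy : ¬ IsTrue r c → Tame r R y) : Tame r R (ite c x y) := by
  by_cases hc : IsTrue r c
  · exact (hx hc).of_rel hr (hc x y)
  · exact (hy hc).of_rel hr (hr.ite_else hc x y)

theorem mac (hr : IsModel r) {j : MacTag} {x : Term N} {a : Agent N} (hx : Tame r R x)
    (h : HonestMac r R j x a) : Tame r R (mac j x (mkey a)) := by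
  obtain ⟨x', e, hx'⟩ := hx
  refine ⟨_, hr.congr_mac j e hr.rfl', .mac j x' a hx' fun ID ha hj => ?_⟩
  obtain ⟨i, hi, e'⟩ := h ID ha hj
  exact ⟨i, hi, hr.trans (hr.symm (hr.congr_fst e)) e'⟩

theorem pair (hr : IsModel r) {x y : Term N} (hx : Tame r R x) (hy : Tame r R y) :
    Tame r R (pair x y) :=
  app hr .pair (by simp) _ (by simpa [Fin.forall_fin_succ] using ⟨hx, hy⟩)

theorem triple (hr : IsModel r) {x y z : Term N} (hx : Tame r R x) (hy : Tame r R y)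
    (hz : Tame r R z) : Tame r R (triple x y z) :=
  app hr .triple (by simp) _ (by simpa [Fin.forall_fin_succ] using ⟨hx, hy, hz⟩)

theorem fst (hr : IsModel r) {x : Term N} (hx : Tame r R x) : Tame r R (fst x) :=
  app hr .fst (by simp) _ (by simpa [Fin.forall_fin_succ] using hx)

theorem snd (hr : IsModel r) {x : Term N} (hx : Tame r R x) : Tame r R (snd x) :=
  app hr .snd (by simp) _ (by simpa [Fin.forall_fin_succ] using hx)

theorem thd (hr : IsModel r) {x : Term N} (hx : Tame r R x) : Tame r R (thd x) :=
  app hr .thd (by simp) _ (by simpa [Fin.forall_fin_succ] using hx)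

theorem sqnSuc (hr : IsModel r) {x : Term N} (hx : Tame r R x) : Tame r R (sqnSuc x) :=
  app hr .sqnSuc (by simp) _ (by simpa [Fin.forall_fin_succ] using hx)

theorem pk (hr : IsModel r) {x : Term N} (hx : Tame r R x) : Tame r R (pk x) :=
  app hr .pk (by simp) _ (by simpa [Fin.forall_fin_succ] using hx)

theorem sk (hr : IsModel r) {x : Term N} (hx : Tame r R x) : Tame r R (sk x) :=
  app hr .sk (by simp) _ (by simpa [Fin.forall_fin_succ] using hx)

theorem xor (hr : IsModel r) {x y : Term N} (hx : Tame r R x) (hy : Tame r R y) :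
    Tame r R (xor x y) :=
  app hr .xor (by simp) _ (by simpa [Fin.forall_fin_succ] using ⟨hx, hy⟩)

theorem owf (hr : IsModel r) {x y : Term N} (hx : Tame r R x) (hy : Tame r R y) :
    Tame r R (owf x y) :=
  app hr .owf (by simp) _ (by simpa [Fin.forall_fin_succ] using ⟨hx, hy⟩)

theorem rowf (hr : IsModel r) {x y : Term N} (hx : Tame r R x) (hy : Tame r R y) :
    Tame r R (rowf x y) :=
  app hr .rowf (by simp) _ (by simpa [Fin.forall_fin_succ] using ⟨hx, hy⟩)

theorem dec (hr : IsModel r) {x y : Term N} (hx : Tame r R x) (hy : Tame r R y) :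
    Tame r R (dec x y) :=
  app hr .dec (by simp) _ (by simpa [Fin.forall_fin_succ] using ⟨hx, hy⟩)

theorem enc (hr : IsModel r) {x y z : Term N} (hx : Tame r R x) (hy : Tame r R y)
    (hz : Tame r R z) : Tame r R (enc x y z) :=
  app hr .enc (by simp) _ (by simpa [Fin.forall_fin_succ] using ⟨hx, hy, hz⟩)

theorem advInput (hr : IsModel r) {φ : List (Term N)} (h : ∀ t ∈ φ, Tame r R t) :
    Tame r R (advInput φ) :=
  app hr (.adv 0 φ.length) (by simp) _ fun i => h _ (List.get_mem φ i)

/-- A message that passes an integrity check was honestly authenticated. -/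
theorem exists_honestMac (hr : IsModel r) {g m : Term N} {j : MacTag} {a : Agent N}
    (hg : Tame r R g) (hm : Tame r R m) (e : r g (Term.mac j m (mkey a))) :
    ∃ x, HonestMac r R j x a ∧ r m x := by
  obtain ⟨g', eg, hg'⟩ := hg
  obtain ⟨m', em, hm'⟩ := hm
  obtain ⟨S₁, hS₁⟩ := exists_enumerates_mac j (mkey a) g'
  obtain ⟨S₂, hS₂⟩ := exists_enumerates_mac j (mkey a) m'
  -- The check is transferred to the clean representatives, because the original terms may contain
  -- `Mac`s that are not honest, for instance inside conditions.
  have e' : r g' (Term.mac j m' (mkey a)) :=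
    hr.trans (hr.symm eg) (hr.trans e (hr.congr_mac j em hr.rfl'))
  have heuf := Deriv.eufMac j (.mkey a) g' m' (S₁ ++ S₂)
    (by simp only [MacKeySafe, List.mem_cons, List.not_mem_nil, or_false, forall_eq_or_imp, forall_eq]
        exact ⟨hg'.onlyAt a, hm'.onlyAt a⟩)
    (fun x => by
      simp only [List.mem_append, hS₁, hS₂, List.mem_cons, List.not_mem_nil, or_false, exists_eq_or_imp,
        exists_eq_left, mkey])
  have h₁ := hr.isTrue_of_tt (hr.of_dEq _ _ (holds_iff_dEq.1 heuf))
  obtain ⟨b, hb, hbt⟩ := hr.exists_of_isTrue_disj (hr.isTrue_imp.1 h₁ (hr.isTrue_eq.2 e'))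
  obtain ⟨x, hx, rfl⟩ := List.mem_map.1 hb
  have hx' : Clean r R x ∧ HonestMac r R j x a := by
    rcases List.mem_append.1 hx with hx | hx
    · exact hg'.of_isSubterm ((hS₁ x).1 hx)
    · exact hm'.of_isSubterm ((hS₂ x).1 hx)
  -- Unforgeability only equates `g'` with the `Mac` of some honest `x`; collision resistance
  -- identifies the messages `m'` and `x`.
  have hcr := Deriv.cr j (.mkey a) m' x
    (by simp only [MacKeySafe, List.mem_cons, List.not_mem_nil, or_false, forall_eq_or_imp, forall_eq]
        exact ⟨hm'.onlyAt a, hx'.1.onlyAt a⟩)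
  have h₂ := hr.isTrue_of_tt (hr.of_dEq _ _ (holds_iff_dEq.1 hcr))
  have h₃ := hr.isTrue_imp.1 h₂
    (hr.isTrue_eq.2 (hr.trans (hr.symm e') (hr.isTrue_eq.1 hbt)))
  exact ⟨x, hx'.2, hr.trans em (hr.isTrue_eq.1 h₃)⟩

end Tame

end Honest

section Execution

variable {N : ℕ} {r : Term N → Term N → Prop} {R R' : ℕ → Fin N → Prop}

/-! ## Execution in a model -/

/-- The selected identity depends on the conditions only, not on `x` and `d`. Hence the chain that
builds the output and the chain that stores the identity select the same one. -/
theorem IsModel.iteChain_cases (hr : IsModel r) (c : Fin N → Term N) :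
    (∃ ID, ∀ x d, r (iteChain c x d) (x ID)) ∨ ∀ x d, r (iteChain c x d) d := by
  unfold iteChain
  induction List.finRange N with
  | nil => exact .inr fun _ _ => hr.rfl'
  | cons I l ih =>
    by_cases hI : IsTrue r (c I)
    · exact .inl ⟨I, fun x d => hI _ _⟩
    · rcases ih with ⟨ID, h⟩ | h
      · exact .inl ⟨ID, fun x d => hr.trans (hr.ite_else hI _ _) (h x d)⟩
      · exact .inr fun x d => hr.trans (hr.ite_else hI _ _) (h x d)

theorem Tame.iteChain (hr : IsModel r) {c x : Fin N → Term N} {d : Term N}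
    (hx : ∀ ID, (∀ y e, r (iteChain c y e) (y ID)) → Tame r R (x ID)) (hd : Tame r R d) :
    Tame r R (iteChain c x d) := by
  rcases hr.iteChain_cases c with ⟨ID, h⟩ | h
  · exact (hx ID h).of_rel hr (h x d)
  · exact hd.of_rel hr (h x d)

theorem honestMac_of_ne {j : MacTag} (h₂ : j ≠ .m2) (h₃ : j ≠ .m3) (x : Term N) (a : Agent N) :
    HonestMac r R j x a := fun _ _ h => (h.elim h₂ h₃).elim

/-- The network session `i` records a claimed identity in the action `a`. -/
def Records (i : ℕ) (a : Action N) : Prop := a = .pn1 i ∨ a = .tn0 i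

/-- The variables whose value is only used as a condition. -/
def Var.IsFlag : Var N → Prop
  | .startedGutiUE _ | .validGutiUE _ | .syncUE _ => True
  | _ => False

/-- Only `pn1` and `tn0` output a `Mac²` or a `Mac³`, and they select the key by the same chain as
the identity they store in `bAuthHN`; `hR` turns this stored value into a record. Under the key of
the dummy identity there is nothing to prove. -/
theorem Tame.output (hr : IsModel r) {σ : State N} {g : Term N} (hσ : ∀ x : Var N, ¬ x.IsFlag → Tame r R (σ x))
    (hg : Tame r R g) (a : Action N)
    (hR : ∀ i ID, Records i a → r ((update σ g a (.bAuthHN i)).getD (σ (.bAuthHN i))) (ident ID) →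
      R i ID) : ∀ t ∈ output σ g a, Tame r R t := by
  have hc : ∀ f h, Tame r R (Term.cst f h) := Tame.cst hr
  have hk : ∀ a, Tame r R (key a : Term N) := fun a => .name hr _ (by simp)
  have hn : ∀ i, Tame r R (chal i : Term N) := fun a => .name hr _ (by simp)
  have hG : ∀ i, Tame r R (newGuti i : Term N) := fun a => .name hr _ (by simp)
  have hs : Tame r R (Term.name .hn) := .name hr _ (by simp)
  intro t ht
  cases a <;> simp only [AKA.output, List.mem_cons, List.not_mem_nil, or_false] at ht <;> subst ht
  case pu0 => exact hc _ _
  case pu1 ID j =>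
    have he : Tame r R (encPU1 σ ID j) :=
      .enc hr (.pair hr (hc _ _) (hσ _ id)) (.pk hr hs) (.name hr _ (by simp))
    exact .pair hr he (.mac hr (.pair hr he hg) (honestMac_of_ne (by simp) (by simp) _ _))
  case pu2 => exact .ite hr (fun _ => hc _ _) fun _ => hc _ _
  case tu0 => exact .ite hr (fun _ => hσ _ id) fun _ => hc _ _
  case tu1 =>
    exact .ite hr (fun _ => .mac hr (.fst hr hg) (honestMac_of_ne (by simp) (by simp) _ _))
      fun _ => hc _ _
  case fu => exact .ite hr (fun _ => hc _ _) fun _ => hc _ _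
  case pn0 => exact hn _
  case pn1 j =>
    refine .iteChain hr (fun ID h => ?_) (hc _ _)
    refine .mac hr (.pair hr (hn j)
      (.sqnSuc hr (.snd hr (.dec hr (.fst hr hg) (.sk hr hs))))) fun ID' e _ => ?_
    obtain rfl := Option.some.inj e
    exact ⟨j, hR j ID (.inl _root_.rfl) (by simpa [update] using h _ _), hr.ax (.fstPair _ _)⟩
  case tn0 j =>
    have hm : ∀ a, HonestMac r R .m3
        (Term.triple (chal j) (σ (.sqnHN a)) (σ (.gutiHN a))) a → Tame r R (msgTN0 σ j a) :=
      fun a h => .triple hr (hn j) (.xor hr (hσ _ id) (.owf hr (hn j) (hk a)))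
        (.mac hr (.triple hr (hn j) (hσ _ id) (hσ _ id)) h)
    refine .iteChain hr (fun ID h => hm _ fun ID' e _ => ?_) (hm _ fun ID' e _ => by cases e)
    obtain rfl := Option.some.inj e
    exact ⟨j, hR j ID (.inr _root_.rfl) (by simpa [update] using h _ _), hr.ax (.fstTriple _ _ _)⟩
  case tn1 => exact .ite hr (fun _ => hc _ _) fun _ => hc _ _
  case fn j =>
    refine .iteChain hr (fun ID h => ?_) (hc _ _)
    exact .pair hr (.xor hr (hG j) (.rowf hr (hn j) (hk _)))
      (.mac hr (.pair hr (hG j) (hn j)) (honestMac_of_ne (by simp) (by simp) _ _))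

/-- Outside the flags, updates use the integrity functions in conditions only, so no new `Mac` is
stored and no new record is needed. Flags are excluded because they store the tests themselves, such
as the `Mac²` of `acceptPU2` in `syncUE`. -/
theorem Tame.update (hr : IsModel r) {σ : State N} {g : Term N} (hσ : ∀ x : Var N, ¬ x.IsFlag → Tame r R (σ x))
    (hg : Tame r R g) (a : Action N) (x : Var N)
    (hx : ¬ x.IsFlag) :
    ∀ t ∈ update σ g a x, Tame r R t := by
  have hc : ∀ f h, Tame r R (Term.cst f h) := Tame.cst hr
  have hk : ∀ a, Tame r R (key a : Term N) := fun a => .name hr _ (by simp)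
  have hn : ∀ i, Tame r R (chal i : Term N) := fun a => .name hr _ (by simp)
  have hG : ∀ i, Tame r R (newGuti i : Term N) := fun a => .name hr _ (by simp)
  have hs : Tame r R (Term.name .hn) := .name hr _ (by simp)
  have hd : Tame r R (decPN1 g) := .dec hr (.fst hr hg) (.sk hr hs)
  have hi : ∀ {c x y}, Tame r R x → Tame r R y → Tame r R (Term.ite c x y) :=
    fun hx hy => .ite hr (fun _ => hx) fun _ => hy
  have hid : ∀ c, Tame r R (AKA.iteChain (N := N) c ident unknownId) :=
    fun c => .iteChain hr (fun _ _ => hc _ _) (hc _ _)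
  have hf : ∀ ID, Tame r R (gutiFU σ g ID) :=
    fun ID => .xor hr (.fst hr hg) (.rowf hr (hσ _ id) (hk _))
  have h₁ : Tame r R (Term.fst g) := .fst hr hg
  have hq : ∀ {x}, Tame r R x → Tame r R (Term.sqnSuc x) := .sqnSuc hr
  rcases x with ID | (_ | ID) | ID | (_ | ID) | ID | ID | j | j | ID | ID | ID | ID <;>
    cases a <;> intro t ht <;> simp only [AKA.update, Option.mem_def, reduceCtorEq, Option.ite_none_right_eq_some,
      Option.some.injEq] at ht
  all_goals first | exact (hx trivial).elim | obtain ⟨-, rfl⟩ := ht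
  all_goals
    first
    | exact hc _ _
    | exact hg
    | exact hid _
    | exact hq (hσ _ id)
    | exact hi (hσ _ id) (hc _ _)
    | exact hi (hq (hσ _ id)) (hσ _ id)
    | exact hi (hq (.snd hr hd)) (hσ _ id)
    | exact hi h₁ (hc _ _)
    | exact hi (hf _) (hc _ _)
    | exact hi (hn _) (hσ _ id)
    | exact hi (hG _) (hσ _ id)
    | exact hi (hc _ _) (hσ _ id)

/-- The only ways to authenticate a network session. -/
theorem eAuthUE_update (hr : IsModel r) {σ : State N} {g : Term N}
    (hσ : ∀ x : Var N, ¬ x.IsFlag → Tame r R (σ x)) (hg : Tame r R g) (a : Action N) (ID : Fin N) :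
    ∀ t ∈ update σ g a (.eAuthUE ID), r t fail ∨ ∃ i, R i ID ∧ r t (chal i) := by
  intro t ht
  have hk : ∀ a, Tame r R (key a : Term N) := fun a => .name hr _ (by simp)
  cases a <;> simp only [AKA.update, Option.mem_def, reduceCtorEq, Option.ite_none_right_eq_some,
      Option.some.injEq] at ht <;> obtain ⟨rfl, rfl⟩ := ht
  case pu1 => exact .inl hr.rfl'
  case tu0 => exact .inl hr.rfl'
  case pu2 =>
    by_cases h : IsTrue r (acceptPU2 σ g ID)
    · right
      obtain ⟨x, hx, e⟩ := Tame.exists_honestMac hr hg (.pair hr (hσ _ id) (hσ _ id))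
        (hr.isTrue_eq.1 h)
      obtain ⟨i, hi, e'⟩ := hx ID rfl (.inl rfl)
      -- The stored value is the first component of the verified message, and `HonestMac` fixes that
      -- component to be a challenge.
      exact ⟨i, hi, hr.trans (h _ _) <| hr.trans (hr.symm (hr.ax (.fstPair _ _))) <|
        hr.trans (hr.congr_fst e) e'⟩
    · exact .inl (hr.ite_else h _ _)
  case tu1 =>
    by_cases h : IsTrue r (acceptTU1 σ g ID)
    · right
      obtain ⟨x, hx, e⟩ := Tame.exists_honestMac hr (.thd hr hg)
        (.triple hr (.fst hr hg) (.xor hr (.snd hr hg) (.owf hr (.fst hr hg) (hk _))) (hσ _ id))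
        (hr.isTrue_eq.1 (hr.isTrue_and.1 h).1)
      obtain ⟨i, hi, e'⟩ := hx ID rfl (.inr rfl)
      exact ⟨i, hi, hr.trans (h _ _) <| hr.trans (hr.symm (hr.ax (.fstTriple _ _ _))) <|
        hr.trans (hr.congr_fst e) e'⟩
    · exact .inl (hr.ite_else h _ _)

/-- In the model `r`, the network session `i` recorded the identity `ID` along the trace `τ`. -/
def Recorded (r : Term N → Term N → Prop) (τ : List (Action N)) (i : ℕ) (ID : Fin N) : Prop :=
  ∃ ρ a, ρ ++ [a] <+: τ ∧ Records i a ∧ r ((exec (ρ ++ [a])).1 (.bAuthHN i)) (ident ID)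

theorem exec_concat (τ : List (Action N)) (a : Action N) : exec (τ ++ [a]) = step (exec τ) a := by
  simp [exec]

/-- Records and clean terms are built up together: a `Mac` sent by an action may rely on the record
made by that same action, so its output is judged by the records of the extended trace. -/
theorem tame_exec (hr : IsModel r) (τ : List (Action N)) :
    (∀ x : Var N, ¬ x.IsFlag → Tame r (Recorded r τ) ((exec τ).1 x)) ∧
      ∀ t ∈ (exec τ).2, Tame r (Recorded r τ) t := by
  induction τ using List.reverseRecOn with
  | nil =>
    have hc : ∀ f h, Tame r (Recorded r []) (Term.cst f h) := Tame.cst hr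
    refine ⟨fun x hx => ?_, fun t ht => ?_⟩
    · cases x <;> exact hc _ _
    · obtain rfl : t = pkHN := by simpa [exec] using ht
      exact .pk hr (.name hr _ (by simp))
  | append_singleton τ a ih =>
    have hR : ∀ i ID, Recorded r τ i ID → Recorded r (τ ++ [a]) i ID := by
      rintro i ID ⟨ρ, b, hp, hb, e⟩
      exact ⟨ρ, b, hp.trans (List.prefix_append _ _), hb, e⟩
    have hσ := fun x hx => (ih.1 x hx).mono hR
    have hφ := fun t ht => (ih.2 t ht).mono hR
    have hg := Tame.advInput hr hφ
    rw [exec_concat]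
    refine ⟨fun x hx => ?_, fun t ht => ?_⟩
    · change Tame r _ ((update (exec τ).1 (advInput (exec τ).2) a x).getD ((exec τ).1 x))
      cases h : update (exec τ).1 (advInput (exec τ).2) a x with
      | none => exact hσ x hx
      | some t => exact Tame.update hr hσ hg a x hx t h
    · rcases List.mem_append.1 ht with ht | ht
      · exact hφ t ht
      -- The recording action is the one being executed, hence the witnesses `τ` and `a`.
      · refine Tame.output hr hσ hg a (fun i ID hi e => ⟨τ, a, List.prefix_rfl, hi, ?_⟩) t ht
        rw [exec_concat]
        exact e

theorem Recorded.mono {τ τ' : List (Action N)} (h : τ <+: τ') {i : ℕ} {ID : Fin N}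
    (hi : Recorded r τ i ID) : Recorded r τ' i ID :=
  let ⟨ρ, a, hp, ha, e⟩ := hi; ⟨ρ, a, hp.trans h, ha, e⟩

/-- Whatever the user authenticated is the challenge of a session that recorded the user. -/
theorem eAuthUE_exec (hr : IsModel r) (τ : List (Action N)) (ID : Fin N) :
    r ((exec τ).1 (.eAuthUE ID)) fail ∨
      ∃ i, Recorded r τ i ID ∧ r ((exec τ).1 (.eAuthUE ID)) (chal i) := by
  induction τ using List.reverseRecOn with
  | nil => exact .inl hr.rfl'
  | append_singleton τ a ih =>
    have hτ := tame_exec hr τ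
    have ht := eAuthUE_update hr hτ.1 (.advInput hr hτ.2) a ID
    have hp : τ <+: τ ++ [a] := List.prefix_append _ _
    have key : ∀ t, (r t fail ∨ ∃ i, Recorded r τ i ID ∧ r t (chal i)) →
        (r t fail ∨ ∃ i, Recorded r (τ ++ [a]) i ID ∧ r t (chal i)) :=
      fun t h => h.imp_right fun ⟨i, hi, e⟩ => ⟨i, hi.mono hp, e⟩
    apply key
    rw [exec_concat]
    change r ((update (exec τ).1 (advInput (exec τ).2) a (.eAuthUE ID)).getD _) _ ∨ ∃ i, _ ∧
      r ((update (exec τ).1 (advInput (exec τ).2) a (.eAuthUE ID)).getD _) _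
    cases h : update (exec τ).1 (advInput (exec τ).2) a (.eAuthUE ID) with
    | none => exact ih
    | some t => exact ht t h

/-! ## A network session records an identity at most once -/

theorem bAuthHN_update_of_not_records {σ : State N} {g : Term N} {a : Action N} {i : ℕ}
    (ha : ¬ Records i a) : update σ g a (.bAuthHN i) = none := by
  cases a <;> simp_all [update, Records, eq_comm]

theorem exec_bAuthHN_append {ρ w : List (Action N)} {i : ℕ} (h : ∀ a ∈ w, ¬ Records i a) :
    (exec (ρ ++ w)).1 (.bAuthHN i) = (exec ρ).1 (.bAuthHN i) := by
  induction w using List.reverseRecOn with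
  | nil => simp
  | append_singleton w a ih =>
    rw [← List.append_assoc, exec_concat]
    change (update _ _ a (.bAuthHN i)).getD _ = _
    rw [bAuthHN_update_of_not_records (h a (by simp))]
    exact ih fun b hb => h b (by simp [hb])

/-- After `pn1` only `fn` can follow, after `tn0` only `tn1` and then `fn`, and `fn` is final. -/
theorem not_records_of_isChain {i : ℕ} {a : Action N} {l : List (Action N)} (ha : Records i a)
    (hl : (a :: l).IsChain (NetStep i)) : ∀ b ∈ l, ¬ Records i b := by
  have hfn : ∀ l : List (Action N), (Action.fn i :: l).IsChain (NetStep i) → l = [] := by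
    intro l h
    cases l with
    | nil => rfl
    | cons b l => cases (List.isChain_cons_cons.1 h).1
  rcases l with - | ⟨b, l⟩
  · simp
  · obtain ⟨h₁, h₂⟩ := List.isChain_cons_cons.1 hl
    rcases ha with rfl | rfl <;> cases h₁
    · obtain rfl := hfn l h₂
      simp [Records]
    · rcases l with - | ⟨c, l⟩
      · simp [Records]
      · obtain ⟨h₃, h₄⟩ := List.isChain_cons_cons.1 h₂
        cases h₃
        obtain rfl := hfn l h₄
        simp [Records]

theorem Records.netSession {i : ℕ} {a : Action N} (h : Records i a) : a.netSession = some i := by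
  rcases h with rfl | rfl <;> rfl

/-- `Recorded` speaks of the value just after the recording action. By validity of the trace no
later action writes `bAuthHN i`, so the value persists. -/
theorem Recorded.exec_bAuthHN {τ τ' : List (Action N)} (hτ : ValidTrace τ) (hp : τ' <+: τ) {i : ℕ}
    {ID : Fin N} (h : Recorded r τ' i ID) :
    (∃ a ∈ τ, a.netSession = some i) ∧ r ((exec τ').1 (.bAuthHN i)) (ident ID) := by
  obtain ⟨ρ, a, ⟨w, rfl⟩, ha, e⟩ := h
  obtain ⟨w', rfl⟩ := hp
  refine ⟨⟨a, by simp, ha.netSession⟩, ?_⟩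
  -- Restricted to the session `i`, the trace from `a` on is a run starting with `a`.
  have hc := (hτ.net i).2
  simp only [List.append_assoc, List.filter_append, List.singleton_append, List.filter_cons,
    ha.netSession, decide_true, if_true] at hc
  have hn := not_records_of_isChain ha hc.right_of_append
  rw [exec_bAuthHN_append]
  · exact e
  · intro b hb hb'
    exact hn b (by simp [hb, hb'.netSession]) hb'

end Execution

end AKA


theorem mainTheorem3 (N : ℕ) (τ : List (AKA.Action N)) (hτ : AKA.ValidTrace τ) (ID : Fin N) :
    (∀ j : ℕ, AKA.Holds
      (AKA.Term.imp (AKA.Term.eq (AKA.stateBefore τ (.eAuthUE ID)) (AKA.chal j))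
        (AKA.Term.disj (τ.inits.map fun τ' =>
          AKA.Term.eq (AKA.stateBefore τ' (.bAuthHN j)) (AKA.Term.ident ID))))) ∧
    (∀ J : List ℕ, (∀ a ∈ τ, ∀ j, a.netSession = some j → j ∈ J) →
      AKA.Holds (AKA.Term.imp (AKA.sucAuth τ ID) (AKA.Term.disj (J.map (AKA.auth τ ID)))) ∧
      AKA.Holds
        (AKA.Term.imp (AKA.sucAuth τ ID) (AKA.Term.disj (J.map (AKA.injAuth τ ID J))))) := by
  open AKA AKA.Term in
  -- Distinct challenges are never identified in a model, since the name `chal j` does not occur in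
  -- the term `chal i`.
  have hne : ∀ {r : Term N → Term N → Prop}, IsModel r → ∀ {t : Term N} {i j : ℕ},
      r t (chal i) → r t (chal j) → i = j := by
    intro r hr t i j hi hj
    by_contra hij
    have h := hr.ax (.eqIndep (chal i : Term N) (.chal j) (by
      simpa [Fresh, IsSubterm, chal] using fun h => hij h.symm))
    exact hr.not_isTrue_ff ((hr.isTrue_congr h).1 (hr.isTrue_eq.2 (hr.trans (hr.symm hi) hj)))
  have hpre : τ.dropLast <+: τ := List.dropLast_prefix τ
  have hsuc : ∀ {r : Term N → Term N → Prop}, IsModel r → IsTrue r (sucAuth τ ID) →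
      ∃ i, (∃ a ∈ τ, a.netSession = some i) ∧ IsTrue r (auth τ ID i) := by
    intro r hr h
    have hf := hr.isTrue_not.1 (hr.isTrue_and.1 h).1
    rcases eAuthUE_exec hr τ.dropLast ID with e | ⟨i, hi, e⟩
    · exact absurd (hr.isTrue_eq.2 e) hf
    · obtain ⟨hs, hb⟩ := hi.exec_bAuthHN hτ hpre
      exact ⟨i, hs, hr.isTrue_and.2 ⟨hr.isTrue_eq.2 hb, hr.isTrue_eq.2 (hr.symm e)⟩⟩
  refine ⟨fun j => holds_of_forall_isModel fun r hr => hr.imp_tt fun h => hr.disj_tt ?_,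
    fun J hJ => ⟨holds_of_forall_isModel fun r hr => hr.imp_tt fun h => hr.disj_tt ?_,
      holds_of_forall_isModel fun r hr => hr.imp_tt fun h => hr.disj_tt ?_⟩⟩
  · have he := hr.isTrue_eq.1 h
    rcases eAuthUE_exec hr τ.dropLast ID with e | ⟨i, hi, e⟩
    · have h' := hr.ax (.eqIndep (fail : Term N) (.chal j) (by
        simp [Fresh, IsSubterm, fail, cst]))
      exact absurd ((hr.isTrue_congr h').1 (hr.isTrue_eq.2 (hr.trans (hr.symm e) he)))
        hr.not_isTrue_ff
    · obtain rfl := hne hr e he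
      -- The prefix `τ` itself serves as witness, because the record persists up to the state before
      -- the last action.
      exact ⟨_, List.mem_map.2 ⟨τ, by simp, rfl⟩, hr.isTrue_eq.2 (hi.exec_bAuthHN hτ hpre).2⟩
  · obtain ⟨i, ⟨a, ha, hai⟩, hi⟩ := hsuc hr h
    exact ⟨_, List.mem_map.2 ⟨i, hJ a ha i hai, rfl⟩, hi⟩
  · obtain ⟨i, ⟨a, ha, hai⟩, hi⟩ := hsuc hr h
    refine ⟨_, List.mem_map.2 ⟨i, hJ a ha i hai, rfl⟩, hr.isTrue_and.2 ⟨hi, hr.isTrue_conj ?_⟩⟩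
    intro b hb
    obtain ⟨j, hj, rfl⟩ := List.mem_map.1 hb
    refine hr.isTrue_not.2 fun hj' => ?_
    -- Two sessions matching the user would both have their challenge equal to the single value of
    -- `eAuthUE`.
    have hij := hne hr (hr.symm (hr.isTrue_eq.1 (hr.isTrue_and.1 hi).2))
      (hr.symm (hr.isTrue_eq.1 (hr.isTrue_and.1 hj').2))
    simp [hij] at hj
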